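/- Let $\theta\in(0,\tfrac12]$ and let $\mathcal S_1$ be the Schreier family, i.e. the family consisting of $\emptyset$ and of all unions $\bigcup_{i=1}^{d} S_i$ of $d\ge 1$ singletons $S_1<\dots<S_d$ of $\mathbb N=\{1,2,\dots\}$ with $d\le \min S_1$. (For nonempty finite $E,F\subset\mathbb N$, $E<F$ means $\max E<\min F$.) On the space $c_{00}$ of finitely supported real sequences, with unit vectors $(e_i)_{i=1}^\infty$, let $\|\cdot\|_0$ be the supremum norm and, for $n\ge 0$, \[ \|x\|_{n+1}=\max\Big\{\|x\|_n,\ \sup\Big\{\theta\sum_{i=1}^d\|E_ix\|_n : d\ge 1,\ E_1<\dots<E_d \text{ nonempty finite subsets of }\mathbb N,\ \{\min E_i\}_{i=1}^d\in\mathcal S_1\Big\}\Big\}, \] where $Ex$ is the restriction of $x$ to the coordinates in $E$. Let $\|x\|=\sup_n\|x\|_n$ and let $T[\theta,\mathcal S_1]$ be the completion of $(c_{00},\|\cdot\|)$. Let $U\colon T[\theta,\mathcal S_1]\to T[\theta,\mathcal S_1]$ be a linear map. Then $U$ is an isometry (not assumed surjective) if and only if $U$ is continuous and there are a $\{-1,1\}$-valued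 sequence $(\varepsilon_i)_{i=1}^\infty$ and a permutation $\pi$ of $\{1,2,\dots,\lfloor\theta^{-1}\rfloor\}$ such that \[ Ue_i=\begin{cases}\varepsilon_i e_{\pi(i)}, & 1\le i\le\lfloor\theta^{-1}\rfloor,\\ \varepsilon_i e_i, & i>\lfloor\theta^{-1}\rfloor.\end{cases} \] -/

import Mathlib

noncomputable section

namespace Tsirelson

/-- `E < F` for finite sets of positive integers: every element of `E` is smaller than every
element of `F` (for nonempty sets, `max E < min F`). -/
def SetLT (E F : Finset ℕ+) : Prop := ∀ i ∈ E, ∀ j ∈ F, i < j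

/-- `E 0 < E 1 < ⋯ < E (d - 1)` are nonempty finite sets of positive integers. -/
structure IsConsecutive {d : ℕ} (E : Fin d → Finset ℕ+) : Prop where
  nonempty : ∀ i, (E i).Nonempty
  lt : ∀ i j, i < j → SetLT (E i) (E j)

/-- The family `𝒜ₙ` of sets with at most `n` elements. -/
def atMost (n : ℕ) : Set (Finset ℕ+) := {F | F.card ≤ n}

/-- The successor step of the Schreier hierarchy: `∅` together with all unions of `d` consecutive
nonempty members of `S` that satisfy `d ≤ S₁ < S₂ < ⋯ < S_d`. -/
def schreierSucc (S : Set (Finset ℕ+)) : Set (Finset ℕ+) :=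
  {F | ∃ (d : ℕ) (G : Fin d → Finset ℕ+), 0 < d ∧ IsConsecutive G ∧ (∀ i, G i ∈ S) ∧
      (∀ i, ∀ n ∈ G i, d ≤ (n : ℕ)) ∧ F = Finset.univ.biUnion G} ∪ {∅}

/-- The Schreier family `𝒮₁`, the successor of `𝒮₀ = 𝒜₁`. -/
def schreierOne : Set (Finset ℕ+) := schreierSucc (atMost 1)

/-- The projection `E x` of a finitely supported sequence `x` to the coordinates in `E`. -/
def proj (E : Finset ℕ+) (x : ℕ+ →₀ ℝ) : ℕ+ →₀ ℝ := x.filter (· ∈ E)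

/-- `E 0 < ⋯ < E (d - 1)`, `d ≥ 1`, are consecutive and the set of their minima is in `F`. -/
def IsAdmissible (F : Set (Finset ℕ+)) {d : ℕ} (E : Fin d → Finset ℕ+) : Prop :=
  0 < d ∧ ∃ h : IsConsecutive E, Finset.univ.image (fun i => (E i).min' (h.nonempty i)) ∈ F

/-- The norms `‖·‖ₙ` on `c₀₀`: `‖·‖₀` is the supremum norm, and `‖x‖ₙ₊₁` is the maximum of `‖x‖ₙ`
and the supremum of `θ ∑ᵢ ‖Eᵢ x‖ₙ` over all admissible `E₁ < ⋯ < E_d`. -/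
def normSeq (θ : ℝ) (F : Set (Finset ℕ+)) : ℕ → (ℕ+ →₀ ℝ) → ℝ
  | 0, x => ⨆ i, |x i|
  | n + 1, x => max (normSeq θ F n x)
      (sSup {r | ∃ (d : ℕ) (E : Fin d → Finset ℕ+), IsAdmissible F E ∧
        r = θ * ∑ i, normSeq θ F n (proj (E i) x)})

/-- The norm `‖x‖ = supₙ ‖x‖ₙ` on `c₀₀`. -/
def tsNorm (θ : ℝ) (F : Set (Finset ℕ+)) (x : ℕ+ →₀ ℝ) : ℝ := ⨆ n, normSeq θ F n x

/-! The next facts show that `tsNorm` is a norm, which is needed to form the completion. -/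

def l1 (x : ℕ+ →₀ ℝ) : ℝ := x.sum fun _ a => |a|

theorem proj_apply (E : Finset ℕ+) (x : ℕ+ →₀ ℝ) (i : ℕ+) :
    proj E x i = if i ∈ E then x i else 0 := by
  simp [proj, Finsupp.filter_apply]

theorem proj_add (E : Finset ℕ+) (x y : ℕ+ →₀ ℝ) : proj E (x + y) = proj E x + proj E y := by
  simp [proj, Finsupp.filter_add]

theorem proj_smul (E : Finset ℕ+) (c : ℝ) (x : ℕ+ →₀ ℝ) : proj E (c • x) = c • proj E x := by
  simp [proj, Finsupp.filter_smul]

theorem bdd_abs (x : ℕ+ →₀ ℝ) : BddAbove (Set.range fun i => |x i|) := by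
  refine ⟨l1 x, ?_⟩
  rintro _ ⟨i, rfl⟩
  by_cases hi : i ∈ x.support
  · exact Finset.single_le_sum (f := fun i => |x i|) (fun _ _ => abs_nonneg _) hi
  · rw [Finsupp.notMem_support_iff] at hi
    simp only [hi, abs_zero]
    exact Finset.sum_nonneg fun _ _ => abs_nonneg _

theorem abs_le_normSeq (θ : ℝ) (F : Set (Finset ℕ+)) (n : ℕ) (x : ℕ+ →₀ ℝ) (i : ℕ+) :
    |x i| ≤ normSeq θ F n x := by
  induction n with
  | zero => exact le_ciSup (bdd_abs x) i
  | succ n ih => exact ih.trans (le_max_left _ _)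

theorem normSeq_nonneg (θ : ℝ) (F : Set (Finset ℕ+)) (n : ℕ) (x : ℕ+ →₀ ℝ) :
    0 ≤ normSeq θ F n x :=
  (abs_nonneg _).trans (abs_le_normSeq θ F n x 1)

theorem abs_le_l1 (x : ℕ+ →₀ ℝ) (i : ℕ+) : |x i| ≤ l1 x := by
  by_cases hi : i ∈ x.support
  · exact Finset.single_le_sum (f := fun i => |x i|) (fun _ _ => abs_nonneg _) hi
  · rw [Finsupp.notMem_support_iff] at hi
    simp only [hi, abs_zero]
    exact Finset.sum_nonneg fun _ _ => abs_nonneg _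

theorem l1_nonneg (x : ℕ+ →₀ ℝ) : 0 ≤ l1 x := Finset.sum_nonneg fun _ _ => abs_nonneg _

theorem l1_proj (E : Finset ℕ+) (x : ℕ+ →₀ ℝ) :
    l1 (proj E x) = ∑ i ∈ x.support, if i ∈ E then |x i| else 0 := by
  rw [l1, Finsupp.sum_of_support_subset (s := x.support)]
  · refine Finset.sum_congr rfl fun i _ => ?_
    rw [proj_apply]
    split_ifs <;> simp
  · simp [proj, Finsupp.support_filter]
  · simp

theorem sum_l1_proj {d : ℕ} {E : Fin d → Finset ℕ+} (h : IsConsecutive E) (x : ℕ+ →₀ ℝ) :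
    ∑ i, l1 (proj (E i) x) ≤ l1 x := by
  simp only [l1_proj]
  rw [Finset.sum_comm, l1]
  refine Finset.sum_le_sum fun k _ => ?_
  by_cases hk : ∃ i, k ∈ E i
  · obtain ⟨i, hi⟩ := hk
    rw [Finset.sum_eq_single i]
    · simp [hi]
    · intro j _ hj
      rw [if_neg]
      intro hkj
      rcases lt_or_gt_of_ne hj with h1 | h1
      · exact lt_irrefl _ (h.lt _ _ h1 k hkj k hi)
      · exact lt_irrefl _ (h.lt _ _ h1 k hi k hkj)
    · simp
  · push Not at hk
    simp [hk]

theorem normSeq_le_l1 {θ : ℝ} (h1 : θ ≤ 1) (F : Set (Finset ℕ+)) (n : ℕ)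
    (x : ℕ+ →₀ ℝ) : normSeq θ F n x ≤ l1 x := by
  induction n generalizing x with
  | zero => exact ciSup_le (abs_le_l1 x)
  | succ n ih =>
    refine max_le (ih x) (Real.sSup_le ?_ (l1_nonneg x))
    rintro _ ⟨d, E, hE, rfl⟩
    obtain ⟨-, hE, -⟩ := hE
    have h2 : ∑ i, normSeq θ F n (proj (E i) x) ≤ l1 x :=
      (Finset.sum_le_sum fun i _ => ih _).trans (sum_l1_proj hE x)
    calc θ * ∑ i, normSeq θ F n (proj (E i) x) ≤ 1 * l1 x :=
          mul_le_mul h1 h2 (Finset.sum_nonneg fun i _ => normSeq_nonneg _ _ _ _) zero_le_one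
      _ = l1 x := one_mul _

theorem bdd_admissible {θ : ℝ} (h1 : θ ≤ 1) (F : Set (Finset ℕ+)) (n : ℕ)
    (x : ℕ+ →₀ ℝ) :
    BddAbove {r | ∃ (d : ℕ) (E : Fin d → Finset ℕ+), IsAdmissible F E ∧
        r = θ * ∑ i, normSeq θ F n (proj (E i) x)} := by
  refine ⟨l1 x, ?_⟩
  rintro _ ⟨d, E, hE, rfl⟩
  obtain ⟨-, hE, -⟩ := hE
  have h2 : ∑ i, normSeq θ F n (proj (E i) x) ≤ l1 x :=
    (Finset.sum_le_sum fun i _ => normSeq_le_l1 h1 F n _).trans (sum_l1_proj hE x)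
  calc θ * ∑ i, normSeq θ F n (proj (E i) x) ≤ 1 * l1 x :=
        mul_le_mul h1 h2 (Finset.sum_nonneg fun i _ => normSeq_nonneg _ _ _ _) zero_le_one
    _ = l1 x := one_mul _

theorem normSeq_add {θ : ℝ} (h0 : 0 ≤ θ) (h1 : θ ≤ 1) (F : Set (Finset ℕ+)) (n : ℕ)
    (x y : ℕ+ →₀ ℝ) : normSeq θ F n (x + y) ≤ normSeq θ F n x + normSeq θ F n y := by
  induction n generalizing x y with
  | zero =>
    refine ciSup_le fun i => ?_
    exact (abs_add_le (x i) (y i)).trans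
      (add_le_add (abs_le_normSeq θ F 0 x i) (abs_le_normSeq θ F 0 y i))
  | succ n ih =>
    refine max_le ((ih x y).trans (add_le_add (le_max_left _ _) (le_max_left _ _)))
      (Real.sSup_le ?_ (add_nonneg (normSeq_nonneg θ F (n + 1) x) (normSeq_nonneg θ F (n + 1) y)))
    rintro _ ⟨d, E, hE, rfl⟩
    have hx : θ * ∑ i, normSeq θ F n (proj (E i) x) ≤ normSeq θ F (n + 1) x :=
      (le_csSup (bdd_admissible h1 F n x) ⟨d, E, hE, rfl⟩).trans (le_max_right _ _)
    have hy : θ * ∑ i, normSeq θ F n (proj (E i) y) ≤ normSeq θ F (n + 1) y :=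
      (le_csSup (bdd_admissible h1 F n y) ⟨d, E, hE, rfl⟩).trans (le_max_right _ _)
    refine le_trans ?_ (add_le_add hx hy)
    rw [← mul_add, ← Finset.sum_add_distrib]
    refine mul_le_mul_of_nonneg_left (Finset.sum_le_sum fun i _ => ?_) h0
    rw [proj_add]
    exact ih _ _

theorem normSeq_smul_le {θ : ℝ} (h0 : 0 ≤ θ) (h1 : θ ≤ 1) (F : Set (Finset ℕ+)) (n : ℕ)
    (c : ℝ) (x : ℕ+ →₀ ℝ) : normSeq θ F n (c • x) ≤ |c| * normSeq θ F n x := by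
  induction n generalizing x with
  | zero =>
    refine ciSup_le fun i => ?_
    rw [Finsupp.smul_apply, smul_eq_mul, abs_mul]
    exact mul_le_mul_of_nonneg_left (abs_le_normSeq θ F 0 x i) (abs_nonneg c)
  | succ n ih =>
    refine max_le ((ih x).trans (mul_le_mul_of_nonneg_left (le_max_left _ _) (abs_nonneg c)))
      (Real.sSup_le ?_ (mul_nonneg (abs_nonneg c) (normSeq_nonneg θ F (n + 1) x)))
    rintro _ ⟨d, E, hE, rfl⟩
    have hx : θ * ∑ i, normSeq θ F n (proj (E i) x) ≤ normSeq θ F (n + 1) x :=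
      (le_csSup (bdd_admissible h1 F n x) ⟨d, E, hE, rfl⟩).trans (le_max_right _ _)
    refine le_trans ?_ (mul_le_mul_of_nonneg_left hx (abs_nonneg c))
    rw [mul_left_comm, Finset.mul_sum (Finset.univ) _ |c|]
    refine mul_le_mul_of_nonneg_left (Finset.sum_le_sum fun i _ => ?_) h0
    rw [proj_smul]
    exact ih _

theorem normSeq_le_tsNorm {θ : ℝ} (h1 : θ ≤ 1) (F : Set (Finset ℕ+)) (n : ℕ)
    (x : ℕ+ →₀ ℝ) : normSeq θ F n x ≤ tsNorm θ F x :=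
  le_ciSup (f := fun n => normSeq θ F n x)
    ⟨l1 x, by rintro _ ⟨n, rfl⟩; exact normSeq_le_l1 h1 F n x⟩ n

theorem tsNorm_add {θ : ℝ} (h0 : 0 ≤ θ) (h1 : θ ≤ 1) (F : Set (Finset ℕ+))
    (x y : ℕ+ →₀ ℝ) : tsNorm θ F (x + y) ≤ tsNorm θ F x + tsNorm θ F y :=
  ciSup_le fun n => (normSeq_add h0 h1 F n x y).trans
    (add_le_add (normSeq_le_tsNorm h1 F n x) (normSeq_le_tsNorm h1 F n y))

theorem tsNorm_smul_le {θ : ℝ} (h0 : 0 ≤ θ) (h1 : θ ≤ 1) (F : Set (Finset ℕ+)) (c : ℝ)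
    (x : ℕ+ →₀ ℝ) : tsNorm θ F (c • x) ≤ |c| * tsNorm θ F x :=
  ciSup_le fun n => (normSeq_smul_le h0 h1 F n c x).trans
    (mul_le_mul_of_nonneg_left (normSeq_le_tsNorm h1 F n x) (abs_nonneg c))

theorem tsNorm_nonneg {θ : ℝ} (h1 : θ ≤ 1) (F : Set (Finset ℕ+))
    (x : ℕ+ →₀ ℝ) : 0 ≤ tsNorm θ F x :=
  (normSeq_nonneg θ F 0 x).trans (normSeq_le_tsNorm h1 F 0 x)

theorem tsNorm_smul {θ : ℝ} (h0 : 0 ≤ θ) (h1 : θ ≤ 1) (F : Set (Finset ℕ+)) (c : ℝ)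
    (x : ℕ+ →₀ ℝ) : tsNorm θ F (c • x) = |c| * tsNorm θ F x := by
  refine le_antisymm (tsNorm_smul_le h0 h1 F c x) ?_
  by_cases hc : c = 0
  · subst hc
    simpa using tsNorm_nonneg h1 F 0
  · have h := tsNorm_smul_le h0 h1 F c⁻¹ (c • x)
    rw [inv_smul_smul₀ hc, abs_inv] at h
    have hc' : 0 < |c| := abs_pos.mpr hc
    calc |c| * tsNorm θ F x ≤ |c| * (|c|⁻¹ * tsNorm θ F (c • x)) :=
          mul_le_mul_of_nonneg_left h hc'.le
      _ = tsNorm θ F (c • x) := by rw [mul_inv_cancel_left₀ hc'.ne']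

theorem eq_zero_of_tsNorm {θ : ℝ} (h1 : θ ≤ 1) (F : Set (Finset ℕ+))
    (x : ℕ+ →₀ ℝ) (h : tsNorm θ F x = 0) : x = 0 := by
  ext i
  have := (abs_le_normSeq θ F 0 x i).trans (normSeq_le_tsNorm h1 F 0 x)
  rw [h] at this
  simpa using this

/-- The space `c₀₀` of finitely supported real sequences `(a₁, a₂, …)`, to be equipped with the
norm of `T[θ, F]`, where `θ ∈ (0, 1/2]`. -/
def C00 (_θ : Set.Ioc (0 : ℝ) (1 / 2)) (_F : Set (Finset ℕ+)) : Type := ℕ+ →₀ ℝ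

instance (θ : Set.Ioc (0 : ℝ) (1 / 2)) (F : Set (Finset ℕ+)) : AddCommGroup (C00 θ F) :=
  inferInstanceAs (AddCommGroup (ℕ+ →₀ ℝ))

instance (θ : Set.Ioc (0 : ℝ) (1 / 2)) (F : Set (Finset ℕ+)) : Module ℝ (C00 θ F) :=
  inferInstanceAs (Module ℝ (ℕ+ →₀ ℝ))

instance (θ : Set.Ioc (0 : ℝ) (1 / 2)) (F : Set (Finset ℕ+)) : Norm (C00 θ F) :=
  ⟨fun x => tsNorm θ F x⟩

theorem normCore (θ : Set.Ioc (0 : ℝ) (1 / 2)) (F : Set (Finset ℕ+)) :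
    NormedSpace.Core ℝ (C00 θ F) := by
  have h0 : 0 ≤ (θ : ℝ) := θ.2.1.le
  have h1 : (θ : ℝ) ≤ 1 := θ.2.2.trans (by norm_num)
  exact
    { norm_nonneg := fun x => tsNorm_nonneg h1 F x
      norm_smul := fun c x => tsNorm_smul h0 h1 F c x
      norm_triangle := fun x y => tsNorm_add h0 h1 F x y
      norm_eq_zero_iff := fun x =>
        ⟨eq_zero_of_tsNorm h1 F x, fun h => by
          subst h
          have := tsNorm_smul h0 h1 F 0 0
          rw [zero_smul, abs_zero, zero_mul] at this
          exact this⟩ }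

instance (θ : Set.Ioc (0 : ℝ) (1 / 2)) (F : Set (Finset ℕ+)) : NormedAddCommGroup (C00 θ F) :=
  NormedAddCommGroup.ofCore (normCore θ F)

instance (θ : Set.Ioc (0 : ℝ) (1 / 2)) (F : Set (Finset ℕ+)) : NormedSpace ℝ (C00 θ F) :=
  NormedSpace.ofCore (normCore θ F)

/-- The combinatorial Tsirelson space `T[θ, F]`: the completion of `c₀₀` for the norm `tsNorm`. -/
abbrev T (θ : Set.Ioc (0 : ℝ) (1 / 2)) (F : Set (Finset ℕ+)) : Type :=
  UniformSpace.Completion (C00 θ F)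

/-- The unit vector `e_i` of `c₀₀`, as an element of `T[θ, F]`. -/
def e (θ : Set.Ioc (0 : ℝ) (1 / 2)) (F : Set (Finset ℕ+)) (i : ℕ+) : T θ F :=
  ((show C00 θ F from Finsupp.single i (1 : ℝ) : C00 θ F) : UniformSpace.Completion (C00 θ F))

end Tsirelson

end

noncomputable section

namespace Tsirelson

/-! Write `N = ⌊θ⁻¹⌋`. If `U` is the signed permutation described, it is isometric because at most
`N` pieces weighted by `θ ≤ 1 / N` never exceed their maximum, while more than `N` admissible pieces
do not see the first `N` coordinates (`tsNorm_le_of_tail`).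

Conversely, let `U` be an isometry. The basis is weakly null (`finite_le_abs_apply_e`, by a
James-type averaging argument), so some `U e_j` live arbitrarily far out, and `‖e_i + e_j‖ ≤ 1`
because `2θ ≤ 1`. Thus `U e_i` can be joined to far unit vectors without raising the norm. Absorbing
such a vector into the last set of an admissible sequence shows that the earlier sets contribute at
most `1 - θ` (`sum_castSucc_le`). This forces `U e_i` to have a coordinate `π i` of modulus one
(`exists_abs_coord_eq_one`), where every other `U e_j` must vanish; in particular `π` is injective.

It remains to locate `π i`. If `π i > m = max i N`, add `m` further indices that `π` also sends
beyond `m`. The image of the sum of these `m + 1` unit vectors has norm at least `θ (m + 1) > 1`,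
but the sum itself has norm at most `max 1 (θ m)`, since an admissible sequence seeing `i` has at
most `m` sets (`index_le_max`). Counting then shows that `π` permutes `{1, …, N}` and fixes
everything beyond, so each `U e_i` has no other coordinates. -/

/-! ### Admissible sequences and the implicit norm equation. -/

theorem IsConsecutive.disjoint {d : ℕ} {E : Fin d → Finset ℕ+} (h : IsConsecutive E)
    {i j : Fin d} {p : ℕ+} (hi : p ∈ E i) (hj : p ∈ E j) : i = j := by
  rcases lt_trichotomy i j with hij | hij | hij
  · exact absurd (h.lt i j hij p hi p hj) (lt_irrefl p)
  · exact hij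
  · exact absurd (h.lt j i hij p hj p hi) (lt_irrefl p)

/-- A sequence of `d` finite sets is `𝒮₁`-admissible iff it is consecutive and `d` is at most the
minimum of their union. -/
theorem isAdmissible_schreierOne_iff {d : ℕ} {E : Fin d → Finset ℕ+} :
    IsAdmissible schreierOne E ↔
      0 < d ∧ IsConsecutive E ∧ ∀ k, ∀ p ∈ E k, d ≤ (p : ℕ) := by
  constructor
  · rintro ⟨hd, hE, hF⟩
    refine ⟨hd, hE, fun k p hp => ?_⟩
    have hinj : Function.Injective fun i => (E i).min' (hE.nonempty i) := fun i j hij =>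
      hE.disjoint ((E i).min'_mem (hE.nonempty i)) (by
        rw [show (E i).min' (hE.nonempty i) = (E j).min' (hE.nonempty j) from hij]
        exact (E j).min'_mem _)
    have hmem : (E k).min' (hE.nonempty k) ∈
        Finset.univ.image (fun i => (E i).min' (hE.nonempty i)) :=
      Finset.mem_image_of_mem _ (Finset.mem_univ k)
    have hle : (((E k).min' (hE.nonempty k) : ℕ+) : ℕ) ≤ p := (E k).min'_le p hp
    -- The `d` distinct minima are covered by `d'` sets of at most one point each, so `d ≤ d'`, and
    -- all of them are at least `d'`.
    rcases hF with ⟨d', G, -, -, hG, hd', hu⟩ | h0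
    · have hcard : d ≤ d' := by
        calc d = (Finset.univ.image (fun i => (E i).min' (hE.nonempty i))).card := by
              rw [Finset.card_image_of_injective _ hinj, Finset.card_fin]
          _ = (Finset.univ.biUnion G).card := by rw [hu]
          _ ≤ ∑ i, (G i).card := Finset.card_biUnion_le
          _ ≤ ∑ _i : Fin d', 1 := Finset.sum_le_sum fun i _ => hG i
          _ = d' := by simp
      rw [hu, Finset.mem_biUnion] at hmem
      obtain ⟨i, -, hi⟩ := hmem
      exact (hcard.trans (hd' i _ hi)).trans hle
    · rw [Set.mem_singleton_iff] at h0
      rw [h0] at hmem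
      simp at hmem
  · rintro ⟨hd, hE, h⟩
    refine ⟨hd, hE, Or.inl ⟨d, fun i => {(E i).min' (hE.nonempty i)}, hd, ⟨fun i => by simp, ?_⟩,
      fun i => by simp [atMost], ?_, ?_⟩⟩
    · intro i j hij p hp q hq
      rw [Finset.mem_singleton] at hp hq
      subst hp hq
      exact hE.lt i j hij _ ((E i).min'_mem _) _ ((E j).min'_mem _)
    · intro i p hp
      rw [Finset.mem_singleton] at hp
      subst hp
      exact h i _ ((E i).min'_mem _)
    · ext p
      simp [eq_comm]

theorem normSeq_monotone (θ : ℝ) (F : Set (Finset ℕ+)) (x : ℕ+ →₀ ℝ) :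
    Monotone fun n => normSeq θ F n x :=
  monotone_nat_of_le_succ fun _ => le_max_left _ _

theorem tendsto_normSeq {θ : ℝ} (h1 : θ ≤ 1) (F : Set (Finset ℕ+)) (x : ℕ+ →₀ ℝ) :
    Filter.Tendsto (fun n => normSeq θ F n x) Filter.atTop (nhds (tsNorm θ F x)) :=
  tendsto_atTop_ciSup (normSeq_monotone θ F x)
    ⟨l1 x, by rintro _ ⟨n, rfl⟩; exact normSeq_le_l1 h1 F n x⟩

theorem abs_le_tsNorm {θ : ℝ} (h1 : θ ≤ 1) (F : Set (Finset ℕ+)) (x : ℕ+ →₀ ℝ) (i : ℕ+) :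
    |x i| ≤ tsNorm θ F x :=
  (abs_le_normSeq θ F 0 x i).trans (normSeq_le_tsNorm h1 F 0 x)

theorem tsNorm_le_l1 {θ : ℝ} (h1 : θ ≤ 1) (F : Set (Finset ℕ+)) (x : ℕ+ →₀ ℝ) :
    tsNorm θ F x ≤ l1 x :=
  ciSup_le fun n => normSeq_le_l1 h1 F n x

/-- With `tsNorm_le`, this amounts to the implicit equation `‖x‖ = max (‖x‖_∞) (θ sup ∑ ‖Eᵢ x‖)`,
which makes the levels `n` dispensable afterwards. -/
theorem admissible_sum_le_tsNorm {θ : ℝ} (h1 : θ ≤ 1) {F : Set (Finset ℕ+)} {d : ℕ}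
    {E : Fin d → Finset ℕ+} (hE : IsAdmissible F E) (x : ℕ+ →₀ ℝ) :
    θ * ∑ i, tsNorm θ F (proj (E i) x) ≤ tsNorm θ F x := by
  refine le_of_tendsto' ((tendsto_finsetSum Finset.univ fun i _ =>
    tendsto_normSeq h1 F (proj (E i) x)).const_mul θ) fun n => ?_
  exact ((le_csSup (bdd_admissible h1 F n x) ⟨d, E, hE, rfl⟩).trans (le_max_right _ _)).trans
    (normSeq_le_tsNorm h1 F (n + 1) x)

theorem tsNorm_le {θ : ℝ} (h0 : 0 ≤ θ) (h1 : θ ≤ 1) {F : Set (Finset ℕ+)} {x : ℕ+ →₀ ℝ} {a : ℝ}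
    (hx : ∀ i, |x i| ≤ a)
    (hE : ∀ (d : ℕ) (E : Fin d → Finset ℕ+), IsAdmissible F E →
      θ * ∑ i, tsNorm θ F (proj (E i) x) ≤ a) : tsNorm θ F x ≤ a := by
  refine ciSup_le fun n => ?_
  induction n with
  | zero => exact ciSup_le hx
  | succ n ih =>
    refine max_le ih (Real.sSup_le ?_ ((abs_nonneg _).trans (hx 1)))
    rintro _ ⟨d, E, hE', rfl⟩
    exact (mul_le_mul_of_nonneg_left
      (Finset.sum_le_sum fun i _ => normSeq_le_tsNorm h1 F n _) h0).trans (hE d E hE')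

theorem normSeq_le_of_abs_le {θ : ℝ} (h0 : 0 ≤ θ) (h1 : θ ≤ 1) (F : Set (Finset ℕ+)) (n : ℕ)
    {x y : ℕ+ →₀ ℝ} (h : ∀ i, |x i| ≤ |y i|) : normSeq θ F n x ≤ normSeq θ F n y := by
  induction n generalizing x y with
  | zero => exact ciSup_le fun i => (h i).trans (abs_le_normSeq θ F 0 y i)
  | succ n ih =>
    refine max_le ((ih h).trans (le_max_left _ _))
      (Real.sSup_le ?_ (normSeq_nonneg θ F (n + 1) y))
    rintro _ ⟨d, E, hE, rfl⟩
    refine le_trans ?_ ((le_csSup (bdd_admissible h1 F n y) ⟨d, E, hE, rfl⟩).trans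
      (le_max_right _ _))
    refine mul_le_mul_of_nonneg_left (Finset.sum_le_sum fun k _ => ih fun i => ?_) h0
    rw [proj_apply, proj_apply]
    split_ifs
    · exact h i
    · exact le_rfl

/-- The unit vectors form a `1`-unconditional system. -/
theorem tsNorm_le_of_abs_le {θ : ℝ} (h0 : 0 ≤ θ) (h1 : θ ≤ 1) (F : Set (Finset ℕ+))
    {x y : ℕ+ →₀ ℝ} (h : ∀ i, |x i| ≤ |y i|) : tsNorm θ F x ≤ tsNorm θ F y :=
  ciSup_le fun n => (normSeq_le_of_abs_le h0 h1 F n h).trans (normSeq_le_tsNorm h1 F n y)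

theorem tsNorm_proj_le {θ : ℝ} (h0 : 0 ≤ θ) (h1 : θ ≤ 1) (F : Set (Finset ℕ+))
    (E : Finset ℕ+) (x : ℕ+ →₀ ℝ) : tsNorm θ F (proj E x) ≤ tsNorm θ F x :=
  tsNorm_le_of_abs_le h0 h1 F fun i => by
    rw [proj_apply]
    split_ifs
    · exact le_rfl
    · simp

theorem tsNorm_zero {θ : ℝ} (h1 : θ ≤ 1) (F : Set (Finset ℕ+)) : tsNorm θ F 0 = 0 :=
  le_antisymm ((tsNorm_le_l1 h1 F 0).trans_eq (by simp [l1])) (tsNorm_nonneg h1 F 0)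

theorem tsNorm_le_max_l1 {θ : ℝ} (h0 : 0 ≤ θ) (h1 : θ ≤ 1) (F : Set (Finset ℕ+))
    {x : ℕ+ →₀ ℝ} {a : ℝ} (hx : ∀ i, |x i| ≤ a) : tsNorm θ F x ≤ max a (θ * l1 x) := by
  refine tsNorm_le h0 h1 (fun i => (hx i).trans (le_max_left _ _)) ?_
  rintro d E ⟨-, hE, -⟩
  refine le_trans (mul_le_mul_of_nonneg_left ?_ h0) (le_max_right _ _)
  exact (Finset.sum_le_sum fun i _ => tsNorm_le_l1 h1 F _).trans (sum_l1_proj hE x)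

/-! ### Norms of sums of unit vectors. -/

/-- The sum of the unit vectors `e_i`, `i ∈ A`. -/
def ones (A : Finset ℕ+) : ℕ+ →₀ ℝ := Finsupp.indicator A fun _ _ => 1

theorem ones_apply (A : Finset ℕ+) (i : ℕ+) : ones A i = if i ∈ A then 1 else 0 := by
  simp [ones, Finsupp.indicator_apply]

theorem proj_ones (E A : Finset ℕ+) : proj E (ones A) = ones (A ∩ E) := by
  ext i
  rw [proj_apply, ones_apply, ones_apply]
  by_cases h : i ∈ E <;> simp [h]

theorem l1_ones (A : Finset ℕ+) : l1 (ones A) = A.card := by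
  rw [l1, Finsupp.sum_of_support_subset (s := A)]
  · rw [Finset.sum_congr rfl (g := fun _ => (1 : ℝ))]
    · simp
    · intro i hi
      simp [ones_apply, hi]
  · exact Finsupp.support_indicator_subset A _
  · simp

theorem tsNorm_ones_le {θ : ℝ} (h0 : 0 ≤ θ) (h1 : θ ≤ 1) (F : Set (Finset ℕ+))
    (A : Finset ℕ+) : tsNorm θ F (ones A) ≤ max 1 (θ * A.card) := by
  rw [← l1_ones]
  refine tsNorm_le_max_l1 h0 h1 F fun i => ?_
  rw [ones_apply]
  split_ifs <;> simp

/-- A set holding two or more ones loses at least one against its cardinality, as `θ |A| ≤ |A| / 2 ≤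
|A| - 1`. -/
theorem tsNorm_ones_le_card_sub_one {θ : ℝ} (h0 : 0 ≤ θ) (h1 : θ ≤ 1 / 2) (F : Set (Finset ℕ+))
    {A : Finset ℕ+} (hA : 2 ≤ A.card) : tsNorm θ F (ones A) ≤ A.card - 1 := by
  have h2 : (2 : ℝ) ≤ A.card := by exact_mod_cast hA
  refine (tsNorm_ones_le h0 (h1.trans (by norm_num)) F A).trans (max_le (by linarith) ?_)
  nlinarith

theorem sum_card_inter_le {d : ℕ} {E : Fin d → Finset ℕ+} (h : IsConsecutive E)
    (A : Finset ℕ+) : ∑ i, ((A ∩ E i).card : ℝ) ≤ A.card := by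
  have := sum_l1_proj h (ones A)
  simpa only [proj_ones, l1_ones] using this

/-- For `i ≤ m` and `|B| ≤ m`, an admissible sequence that meets `i` has at most `m` sets, so it
cannot separate the points of `{i} ∪ B`. -/
theorem tsNorm_ones_insert_le {θ : ℝ} (h0 : 0 ≤ θ) (h1 : θ ≤ 1 / 2) {i : ℕ+} {m : ℕ}
    (him : (i : ℕ) ≤ m) {B : Finset ℕ+} (hBm : B.card ≤ m) :
    tsNorm θ schreierOne (ones (insert i B)) ≤ max 1 (θ * m) := by
  have h1' : θ ≤ 1 := h1.trans (by norm_num)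
  refine tsNorm_le h0 h1' (fun p => ?_) fun d E hE => ?_
  · rw [ones_apply]
    split_ifs <;> simp
  obtain ⟨hd, hEc, hmin⟩ := isAdmissible_schreierOne_iff.1 hE
  by_cases hmeet : ∃ k, i ∈ E k
  · obtain ⟨k₀, hk₀⟩ := hmeet
    have hdm : d ≤ m := (hmin k₀ i hk₀).trans him
    refine le_trans (mul_le_mul_of_nonneg_left ?_ h0) (le_max_right _ _)
    simp only [proj_ones]
    -- There are at most `m + 1` points and at most `m` sets: either some set holds two points and
    -- loses one from the total, or every set contributes at most one.
    by_cases hbig : ∃ k, 2 ≤ (insert i B ∩ E k).card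
    · obtain ⟨k, hk⟩ := hbig
      have hsum := sum_card_inter_le hEc (insert i B)
      have hcard : ((insert i B).card : ℝ) ≤ m + 1 := by
        exact_mod_cast (Finset.card_insert_le i B).trans (Nat.succ_le_succ hBm)
      have hrest : ∑ j ∈ Finset.univ.erase k, tsNorm θ schreierOne (ones (insert i B ∩ E j)) ≤
          ∑ j ∈ Finset.univ.erase k, ((insert i B ∩ E j).card : ℝ) :=
        Finset.sum_le_sum fun j _ => (tsNorm_le_l1 h1' _ _).trans_eq (l1_ones _)
      rw [← Finset.add_sum_erase _ _ (Finset.mem_univ k)] at hsum ⊢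
      have := tsNorm_ones_le_card_sub_one h0 h1 schreierOne hk
      linarith
    · push Not at hbig
      calc ∑ k, tsNorm θ schreierOne (ones (insert i B ∩ E k)) ≤ ∑ _k : Fin d, (1 : ℝ) := by
            refine Finset.sum_le_sum fun k _ => (tsNorm_le_l1 h1' _ _).trans ?_
            rw [l1_ones]
            exact_mod_cast Nat.lt_succ_iff.1 (hbig k)
        _ = d := by simp
        _ ≤ m := by exact_mod_cast hdm
  · push Not at hmeet
    have hproj : ∀ k, proj (E k) (ones (insert i B)) = proj (E k) (ones B) := fun k => by
      rw [proj_ones, proj_ones, Finset.insert_inter_of_notMem (hmeet k)]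
    simp only [hproj]
    refine (admissible_sum_le_tsNorm h1' hE _).trans ((tsNorm_ones_le h0 h1' _ _).trans ?_)
    refine max_le_max le_rfl (mul_le_mul_of_nonneg_left ?_ h0)
    exact_mod_cast hBm

/-! ### The initial coordinates as an `ℓ_∞`-summand. -/

/-- The hypotheses on `x` pass to its projections, so by induction `d ≤ N` pieces give at most `θ d
a ≤ a`. If `d > N`, all sets lie beyond `N`, where `y` dominates `x`. -/
theorem normSeq_le_of_tail {θ : ℝ} (h0 : 0 ≤ θ) (h1 : θ ≤ 1) {N : ℕ} (hN : θ * N ≤ 1) {a : ℝ}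
    (n : ℕ) {x y : ℕ+ →₀ ℝ} (hx : ∀ i : ℕ+, (i : ℕ) ≤ N → |x i| ≤ a)
    (hxy : ∀ i : ℕ+, N < (i : ℕ) → |x i| ≤ |y i|) (hy : tsNorm θ schreierOne y ≤ a) :
    normSeq θ schreierOne n x ≤ a := by
  have ha : 0 ≤ a := (tsNorm_nonneg h1 _ y).trans hy
  induction n generalizing x with
  | zero =>
    refine ciSup_le fun i => ?_
    rcases le_or_gt (i : ℕ) N with hi | hi
    · exact hx i hi
    · exact (hxy i hi).trans ((abs_le_tsNorm h1 _ y i).trans hy)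
  | succ n ih =>
    refine max_le (ih hx hxy) (Real.sSup_le ?_ ha)
    rintro _ ⟨d, E, hE, rfl⟩
    obtain ⟨-, hEc, hmin⟩ := isAdmissible_schreierOne_iff.1 hE
    have habs : ∀ k i, |proj (E k) x i| ≤ |x i| := fun k i => by
      rw [proj_apply]
      split_ifs <;> simp
    rcases le_or_gt d N with hd | hd
    · calc θ * ∑ k, normSeq θ schreierOne n (proj (E k) x) ≤ θ * ∑ _k : Fin d, a := by
            refine mul_le_mul_of_nonneg_left (Finset.sum_le_sum fun k _ => ?_) h0
            exact ih (fun i hi => (habs k i).trans (hx i hi))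
              fun i hi => (habs k i).trans (hxy i hi)
        _ = θ * d * a := by simp; ring
        _ ≤ θ * N * a := by
            refine mul_le_mul_of_nonneg_right (mul_le_mul_of_nonneg_left ?_ h0) ha
            exact_mod_cast hd
        _ ≤ 1 * a := mul_le_mul_of_nonneg_right hN ha
        _ = a := one_mul a
    · refine le_trans (mul_le_mul_of_nonneg_left (Finset.sum_le_sum fun k _ => ?_) h0)
        ((admissible_sum_le_tsNorm h1 hE y).trans hy)
      refine (normSeq_le_of_abs_le h0 h1 _ n fun i => ?_).trans (normSeq_le_tsNorm h1 _ n _)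
      rw [proj_apply, proj_apply]
      split_ifs with hi
      · exact hxy i (hd.trans_le (hmin k i hi))
      · exact le_rfl

/-- The coordinates up to `N ≤ θ⁻¹` form an `ℓ_∞`-summand, so they may be permuted. -/
theorem tsNorm_le_of_tail {θ : ℝ} (h0 : 0 ≤ θ) (h1 : θ ≤ 1) {N : ℕ} (hN : θ * N ≤ 1)
    {x y : ℕ+ →₀ ℝ} (hx : ∀ i : ℕ+, (i : ℕ) ≤ N → ∃ j, |x i| ≤ |y j|)
    (hxy : ∀ i : ℕ+, N < (i : ℕ) → |x i| ≤ |y i|) :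
    tsNorm θ schreierOne x ≤ tsNorm θ schreierOne y :=
  ciSup_le fun n => normSeq_le_of_tail h0 h1 hN n
    (fun i hi => (hx i hi).elim fun j hj => hj.trans (abs_le_tsNorm h1 _ y j)) hxy le_rfl

/-! ### Averages of successive blocks; small convex combinations of unit vectors. -/

theorem proj_sum {ι : Type*} (E : Finset ℕ+) (s : Finset ι) (x : ι → ℕ+ →₀ ℝ) :
    proj E (∑ l ∈ s, x l) = ∑ l ∈ s, proj E (x l) := by
  ext i
  simp only [proj_apply, Finsupp.finsetSum_apply]
  split_ifs <;> simp

theorem tsNorm_sum_le {θ : ℝ} (h0 : 0 ≤ θ) (h1 : θ ≤ 1) (F : Set (Finset ℕ+)) {ι : Type*}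
    (s : Finset ι) (x : ι → ℕ+ →₀ ℝ) :
    tsNorm θ F (∑ l ∈ s, x l) ≤ ∑ l ∈ s, tsNorm θ F (x l) :=
  Finset.le_sum_of_subadditive _ (tsNorm_zero h1 F).le (tsNorm_add h0 h1 F) s x

/-- Among `d` consecutive sets and `r` successive blocks, at most `r + d` pairs meet. -/
theorem sum_proj_blocks_le {θ : ℝ} (h0 : 0 ≤ θ) (h1 : θ ≤ 1) (F : Set (Finset ℕ+)) {d : ℕ}
    {E : Fin d → Finset ℕ+} (hE : IsConsecutive E) {x : ℕ → ℕ+ →₀ ℝ} {C : ℝ} (hC : 0 ≤ C)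
    (hx : ∀ l, tsNorm θ F (x l) ≤ C)
    (hlt : ∀ l l', l < l' → ∀ p q, x l p ≠ 0 → x l' q ≠ 0 → p < q) (r : ℕ) :
    ∑ k, ∑ l ∈ Finset.range r, tsNorm θ F (proj (E k) (x l)) ≤ (r + d) * C := by
  classical
  rw [← Finset.sum_product']
  set S : Finset (Fin d × ℕ) :=
    (Finset.univ ×ˢ Finset.range r).filter fun q => proj (E q.1) (x q.2) ≠ 0 with hS
  have hmeet : ∀ q ∈ S, ∃ p, p ∈ E q.1 ∧ x q.2 p ≠ 0 := by
    intro q hq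
    obtain ⟨p, hp⟩ := Finsupp.ne_iff.1 (Finset.mem_filter.1 hq).2
    rw [proj_apply, Finsupp.zero_apply] at hp
    by_cases hpE : p ∈ E q.1
    · exact ⟨p, hpE, by simpa [hpE] using hp⟩
    · simp [hpE] at hp
  -- Meeting pairs form a staircase: a later set cannot meet an earlier block once the order is
  -- reversed. Hence `(k, l) ↦ k + l` is injective on them.
  have hcard : S.card ≤ r + d := by
    have hmaps : ∀ q ∈ S, (q.1 : ℕ) + q.2 ∈ Finset.range (r + d) := by
      intro q hq
      have h2 := Finset.mem_range.1 (Finset.mem_product.1 (Finset.mem_filter.1 hq).1).2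
      have h3 := q.1.2
      rw [Finset.mem_range]
      lia
    have hinj : Set.InjOn (fun q : Fin d × ℕ => (q.1 : ℕ) + q.2) S := by
      have key : ∀ q ∈ S, ∀ q' ∈ S, (q.1 : ℕ) + q.2 = q'.1 + q'.2 → ¬ q.1 < q'.1 := by
        intro q hq q' hq' hsum hlt'
        obtain ⟨p, hpE, hp⟩ := hmeet q hq
        obtain ⟨p', hpE', hp'⟩ := hmeet q' hq'
        have hl : q'.2 < q.2 := by
          have : (q.1 : ℕ) < q'.1 := hlt'
          lia
        exact lt_asymm (hE.lt _ _ hlt' p hpE p' hpE') (hlt _ _ hl p' p hp' hp)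
      intro q hq q' hq' hsum
      have h2 : q.1 = q'.1 :=
        le_antisymm (not_lt.1 (key q' hq' q hq hsum.symm)) (not_lt.1 (key q hq q' hq' hsum))
      refine Prod.ext h2 ?_
      simp only [h2] at hsum
      lia
    simpa using Finset.card_le_card_of_injOn _ hmaps hinj
  calc ∑ q ∈ Finset.univ ×ˢ Finset.range r, tsNorm θ F (proj (E q.1) (x q.2))
      = ∑ q ∈ S, tsNorm θ F (proj (E q.1) (x q.2)) := by
        rw [hS, Finset.sum_filter_of_ne]
        intro q _ hq h
        rw [h, tsNorm_zero h1] at hq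
        exact hq rfl
    _ ≤ ∑ _q ∈ S, C := Finset.sum_le_sum fun q _ => (tsNorm_proj_le h0 h1 F _ _).trans (hx _)
    _ = S.card * C := by simp
    _ ≤ (r + d) * C := mul_le_mul_of_nonneg_right (by exact_mod_cast hcard) hC

/-- Adding a long average of successive blocks to a vector supported in `{1, …, n}`. -/
theorem tsNorm_add_average_le {θ : ℝ} (h0 : 0 ≤ θ) (h1 : θ ≤ 1) {n r : ℕ} (hr : 0 < r)
    {y : ℕ+ →₀ ℝ} {x : ℕ → ℕ+ →₀ ℝ} {C : ℝ} (hy : tsNorm θ schreierOne y ≤ C)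
    (hx : ∀ l, tsNorm θ schreierOne (x l) ≤ C) (hyn : ∀ p, y p ≠ 0 → (p : ℕ) ≤ n)
    (hxn : ∀ l p, x l p ≠ 0 → n < (p : ℕ))
    (hlt : ∀ l l', l < l' → ∀ p q, x l p ≠ 0 → x l' q ≠ 0 → p < q) :
    tsNorm θ schreierOne (y + (r : ℝ)⁻¹ • ∑ l ∈ Finset.range r, x l) ≤
      C * (1 + θ * (1 + n / r)) := by
  have hr' : (0 : ℝ) < r := by exact_mod_cast hr
  have hC : 0 ≤ C := (tsNorm_nonneg h1 _ y).trans hy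
  set z := (r : ℝ)⁻¹ • ∑ l ∈ Finset.range r, x l with hz
  have hCle : C ≤ C * (1 + θ * (1 + n / r)) := by
    have : 0 ≤ θ * (1 + n / r) := by positivity
    nlinarith
  have hzC : tsNorm θ schreierOne z ≤ C := by
    rw [hz, tsNorm_smul h0 h1, abs_of_pos (inv_pos.2 hr'), inv_mul_le_iff₀ hr']
    calc _ ≤ ∑ l ∈ Finset.range r, tsNorm θ schreierOne (x l) := tsNorm_sum_le h0 h1 _ _ _
      _ ≤ ∑ _l ∈ Finset.range r, C := Finset.sum_le_sum fun l _ => hx l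
      _ = r * C := by simp
  have hzn : ∀ p : ℕ+, (p : ℕ) ≤ n → z p = 0 := by
    intro p hp
    rw [hz, Finsupp.smul_apply, Finsupp.finsetSum_apply, Finset.sum_eq_zero, smul_zero]
    intro l _
    by_contra h
    exact absurd (hxn l p h) (not_lt.2 hp)
  have hyn' : ∀ p : ℕ+, n < (p : ℕ) → y p = 0 := fun p hp => by
    by_contra h
    exact absurd (hyn p h) (not_le.2 hp)
  refine tsNorm_le h0 h1 (fun p => ?_) fun d E hE => ?_
  · refine le_trans ?_ hCle
    rw [Finsupp.add_apply]
    rcases le_or_gt (p : ℕ) n with hp | hp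
    · rw [hzn p hp, add_zero]
      exact (abs_le_tsNorm h1 _ y p).trans hy
    · rw [hyn' p hp, zero_add]
      exact (abs_le_tsNorm h1 _ z p).trans hzC
  · obtain ⟨-, hEc, hmin⟩ := isAdmissible_schreierOne_iff.1 hE
    -- With `d ≤ n`, the block count bounds the average's share by `θ C (r + n) / r`. With `d > n`,
    -- the sets start beyond `n` and miss `y`.
    rcases le_or_gt d n with hd | hd
    · have hsplit : ∑ k, tsNorm θ schreierOne (proj (E k) (y + z)) ≤
          ∑ k, tsNorm θ schreierOne (proj (E k) y) +
            (r : ℝ)⁻¹ * ∑ k, ∑ l ∈ Finset.range r, tsNorm θ schreierOne (proj (E k) (x l)) := by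
        rw [Finset.mul_sum, ← Finset.sum_add_distrib]
        refine Finset.sum_le_sum fun k _ => ?_
        rw [proj_add]
        refine (tsNorm_add h0 h1 _ _ _).trans ?_
        rw [hz, proj_smul, tsNorm_smul h0 h1, abs_of_pos (inv_pos.2 hr'), proj_sum]
        have := tsNorm_sum_le h0 h1 schreierOne (Finset.range r) fun l => proj (E k) (x l)
        gcongr
      have hA := (admissible_sum_le_tsNorm h1 hE y).trans hy
      have hB := sum_proj_blocks_le h0 h1 schreierOne hEc hC hx hlt r
      have hd' : ((r : ℝ) + d) * C ≤ (r + n) * C := by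
        have : (d : ℝ) ≤ n := by exact_mod_cast hd
        gcongr
      calc _ ≤ θ * (∑ k, tsNorm θ schreierOne (proj (E k) y) + (r : ℝ)⁻¹ * ((r + n) * C)) := by
            refine mul_le_mul_of_nonneg_left (hsplit.trans ?_) h0
            have := hB.trans hd'
            gcongr
        _ ≤ C + θ * ((r : ℝ)⁻¹ * ((r + n) * C)) := by rw [mul_add]; gcongr
        _ = C * (1 + θ * (1 + n / r)) := by field_simp
    · have hproj : ∀ k, proj (E k) (y + z) = proj (E k) z := fun k => by
        ext p
        rw [proj_apply, proj_apply]
        split_ifs with hp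
        · rw [Finsupp.add_apply, hyn' p (hd.trans_le (hmin k p hp)), zero_add]
        · rfl
      simp only [hproj]
      exact ((admissible_sum_le_tsNorm h1 hE z).trans hzC).trans hCle

/-- The convex combinations of the unit vectors `e_j` with `j ∈ L`, `j > m`. -/
def combos (L : Set ℕ+) (m : ℕ) : Set (ℕ+ →₀ ℝ) :=
  convexHull ℝ ((fun j => Finsupp.single j (1 : ℝ)) '' {j | j ∈ L ∧ m < (j : ℕ)})

theorem combos_anti (L : Set ℕ+) {m n : ℕ} (h : m ≤ n) : combos L n ⊆ combos L m :=
  convexHull_mono (Set.image_mono fun _ hj => ⟨hj.1, h.trans_lt hj.2⟩)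

theorem combos_nonempty {L : Set ℕ+} (hL : L.Infinite) (m : ℕ) : (combos L m).Nonempty := by
  have : ∃ j ∈ L, m < (j : ℕ) := by
    obtain ⟨j, hj, hmj⟩ := hL.exists_gt m.succPNat
    have : (m.succPNat : ℕ) < j := hmj
    rw [Nat.succPNat_coe] at this
    exact ⟨j, hj, by lia⟩
  obtain ⟨j, hj⟩ := this
  exact ⟨_, subset_convexHull ℝ _ ⟨j, hj, rfl⟩⟩

theorem combos_support {L : Set ℕ+} {m : ℕ} {x : ℕ+ →₀ ℝ} (hx : x ∈ combos L m) {p : ℕ+}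
    (hp : x p ≠ 0) : m < (p : ℕ) := by
  by_contra hmp
  refine hp (convexHull_min (t := {x : ℕ+ →₀ ℝ | x p = 0}) ?_ ?_ hx)
  · rintro _ ⟨j, ⟨-, hj⟩, rfl⟩
    refine Finsupp.single_eq_of_ne fun h => hmp ?_
    rwa [h]
  · exact (convex_singleton 0).is_linear_preimage
      (Finsupp.lapply p : (ℕ+ →₀ ℝ) →ₗ[ℝ] ℝ).isLinear

/-- No subsequence of the unit vector basis is equivalent to the basis of `ℓ₁`. -/
theorem exists_combos_tsNorm_lt {θ : ℝ} (h0 : 0 ≤ θ) (h1 : θ ≤ 1 / 2) {L : Set ℕ+}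
    (hL : L.Infinite) {δ : ℝ} (hδ : 0 < δ) :
    ∃ x ∈ combos L 0, tsNorm θ schreierOne x < δ := by
  have h1' : θ ≤ 1 := h1.trans (by norm_num)
  by_contra! hlow
  -- James' argument: `c m` increases to `s > 0`, so far out the minimal norm of a convex
  -- combination is almost constant. Averaging two suitable near-minimizers will fall below it.
  set c : ℕ → ℝ := fun m => sInf (tsNorm θ schreierOne '' combos L m) with hc
  have hbelow : ∀ m, BddBelow (tsNorm θ schreierOne '' combos L m) := fun m =>
    ⟨0, by rintro _ ⟨x, -, rfl⟩; exact tsNorm_nonneg h1' _ x⟩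
  have hc_le : ∀ m, ∀ x ∈ combos L m, c m ≤ tsNorm θ schreierOne x := fun m x hx =>
    csInf_le (hbelow m) ⟨x, hx, rfl⟩
  have hc_one : ∀ m, c m ≤ 1 := fun m => by
    obtain ⟨_, j, hj, rfl⟩ := convexHull_nonempty_iff.1 (combos_nonempty hL m)
    refine (hc_le m _ (subset_convexHull ℝ _ ⟨j, hj, rfl⟩)).trans ?_
    refine (tsNorm_le_l1 h1' _ _).trans ?_
    simp [l1]
  have hc_bdd : BddAbove (Set.range c) := ⟨1, by rintro _ ⟨m, rfl⟩; exact hc_one m⟩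
  set s := ⨆ m, c m with hs
  have hs_pos : 0 < s := by
    refine hδ.trans_le (le_trans ?_ (le_ciSup hc_bdd 0))
    refine le_csInf ((combos_nonempty hL 0).image _) ?_
    rintro _ ⟨x, hx, rfl⟩
    exact hlow x hx
  obtain ⟨m, hm⟩ := exists_lt_of_lt_ciSup (show s - s / 20 < ⨆ m, c m by rw [← hs]; linarith)
  have hex : ∀ m, ∃ x ∈ combos L m, tsNorm θ schreierOne x < s + s / 20 := fun m => by
    have : c m < s + s / 20 := (le_ciSup hc_bdd m).trans_lt (by linarith)
    obtain ⟨_, ⟨x, hx, rfl⟩, hlt⟩ := exists_lt_of_csInf_lt ((combos_nonempty hL m).image _) this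
    exact ⟨x, hx, hlt⟩
  choose X hX hXs using hex
  let top : (ℕ+ →₀ ℝ) → ℕ := fun x => x.support.sup fun p => (p : ℕ)
  have htop : ∀ (x : ℕ+ →₀ ℝ) p, x p ≠ 0 → (p : ℕ) ≤ top x := fun x p hp =>
    Finset.le_sup (f := fun p : ℕ+ => (p : ℕ)) (Finsupp.mem_support_iff.2 hp)
  set n := max m (top (X m)) with hn
  -- `b (l + 1)` is at least the end of the support of `X (b l)`, which makes the `X (b l)`
  -- successive.
  let b : ℕ → ℕ := fun l => Nat.rec n (fun _ t => max t (top (X t))) l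
  have hb_mono : Monotone b := monotone_nat_of_le_succ fun l => le_max_left _ _
  have hnb : ∀ l, n ≤ b l := fun l => hb_mono (Nat.zero_le l)
  obtain ⟨r, hr⟩ := exists_nat_gt (20 * (n : ℝ))
  have hr0 : (0 : ℝ) < r := lt_of_le_of_lt (by positivity) hr
  have hr1 : 0 < r := by exact_mod_cast hr0
  have hup := tsNorm_add_average_le h0 h1' (n := n) hr1 (y := X m) (x := fun l => X (b l))
    (hXs m).le (fun l => (hXs _).le) (fun p hp => (htop _ p hp).trans (le_max_right _ _))
    (fun l p hp => (hnb l).trans_lt (combos_support (hX _) hp)) (by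
      intro l l' hll p q hp hq
      have h2 : (p : ℕ) ≤ b (l + 1) := (htop _ p hp).trans (le_max_right _ _)
      have h3 : b l' < (q : ℕ) := combos_support (hX _) hq
      have h4 : b (l + 1) ≤ b l' := hb_mono hll
      have : (p : ℕ) < q := by lia
      exact this)
  set z := (r : ℝ)⁻¹ • ∑ l ∈ Finset.range r, X (b l) with hz
  have hzmem : z ∈ combos L m := by
    rw [hz, Finset.smul_sum]
    refine (convex_convexHull ℝ _).sum_mem (fun _ _ => inv_nonneg.2 hr0.le) ?_ ?_
    · rw [Finset.sum_const, Finset.card_range, nsmul_eq_mul, mul_inv_cancel₀ hr0.ne']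
    · exact fun l _ => combos_anti L ((le_max_left _ _).trans (hnb l)) (hX _)
  have hmid : (1 / 2 : ℝ) • X m + (1 / 2 : ℝ) • z ∈ combos L m :=
    convex_convexHull ℝ _ (hX m) hzmem (by norm_num) (by norm_num) (by norm_num)
  have hdown := hc_le m _ hmid
  rw [← smul_add, tsNorm_smul h0 h1', abs_of_pos (by norm_num : (0 : ℝ) < 1 / 2)] at hdown
  have hnr : (n : ℝ) / r ≤ 1 / 20 := by
    rw [div_le_iff₀ hr0]
    linarith
  have hfac : θ * (1 + n / r) ≤ 1 / 2 * (1 + 1 / 20) := by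
    have : (0 : ℝ) ≤ n / r := by positivity
    gcongr
  -- The midpoint has norm at most `(1 / 2) (21 / 20) (61 / 40) s < 0.81 s`, yet at least `c m >
  -- 0.95 s`.
  have hfin : (s + s / 20) * (1 + θ * (1 + n / r)) ≤
      (s + s / 20) * (1 + 1 / 2 * (1 + 1 / 20)) := by
    gcongr
  linarith

/-! ### Coordinates, projections and tails on the completion. -/

section Completion

variable {θ : Set.Ioc (0 : ℝ) (1 / 2)} {F : Set (Finset ℕ+)}

theorem coe_le_one (θ : Set.Ioc (0 : ℝ) (1 / 2)) : (θ : ℝ) ≤ 1 := θ.2.2.trans (by norm_num)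

/-- The canonical embedding of `c₀₀` into `T[θ, F]`. -/
def emb (θ : Set.Ioc (0 : ℝ) (1 / 2)) (F : Set (Finset ℕ+)) : (ℕ+ →₀ ℝ) →ₗ[ℝ] T θ F :=
  (UniformSpace.Completion.toComplₗᵢ (𝕜 := ℝ) (E := C00 θ F)).toLinearMap

theorem norm_emb (x : ℕ+ →₀ ℝ) : ‖emb θ F x‖ = tsNorm θ F x :=
  UniformSpace.Completion.norm_coe (E := C00 θ F) x

theorem emb_single (i : ℕ+) : emb θ F (Finsupp.single i 1) = e θ F i := rfl

theorem denseRange_emb : DenseRange (emb θ F) :=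
  UniformSpace.Completion.denseRange_coe (α := C00 θ F)

theorem norm_lapply_le (k : ℕ+) (x : ℕ+ →₀ ℝ) :
    ‖(Finsupp.lapply k : (ℕ+ →₀ ℝ) →ₗ[ℝ] ℝ) x‖ ≤ 1 * ‖emb θ F x‖ := by
  rw [one_mul, norm_emb]
  exact abs_le_tsNorm (coe_le_one θ) F x k

/-- The `k`-th coordinate functional on `T[θ, F]`. -/
def coord (θ : Set.Ioc (0 : ℝ) (1 / 2)) (F : Set (Finset ℕ+)) (k : ℕ+) : T θ F →L[ℝ] ℝ :=
  (Finsupp.lapply k : (ℕ+ →₀ ℝ) →ₗ[ℝ] ℝ).extendOfNorm (emb θ F)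

theorem coord_emb (k : ℕ+) (x : ℕ+ →₀ ℝ) : coord θ F k (emb θ F x) = x k :=
  LinearMap.extendOfNorm_eq denseRange_emb ⟨1, norm_lapply_le k⟩ x

theorem abs_coord_le (k : ℕ+) (x : T θ F) : |coord θ F k x| ≤ ‖x‖ :=
  (LinearMap.norm_extendOfNorm_apply_le denseRange_emb 1 (norm_lapply_le k) x).trans_eq
    (one_mul _)

theorem coord_e (k i : ℕ+) : coord θ F k (e θ F i) = if i = k then 1 else 0 := by
  rw [← emb_single, coord_emb, Finsupp.single_apply]

/-- The projection of `T[θ, F]` to the coordinates in a finite set. -/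
def projT (θ : Set.Ioc (0 : ℝ) (1 / 2)) (F : Set (Finset ℕ+)) (E : Finset ℕ+) :
    T θ F →L[ℝ] T θ F :=
  ∑ k ∈ E, (coord θ F k).smulRight (e θ F k)

theorem projT_apply (E : Finset ℕ+) (x : T θ F) :
    projT θ F E x = ∑ k ∈ E, coord θ F k x • e θ F k := by
  simp [projT]

theorem projT_emb (E : Finset ℕ+) (x : ℕ+ →₀ ℝ) :
    projT θ F E (emb θ F x) = emb θ F (proj E x) := by
  simp only [projT_apply, coord_emb, ← emb_single, ← map_smul, ← map_sum]
  congr 1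
  ext i
  simp [proj_apply, Finsupp.single_apply]

theorem coord_projT (k : ℕ+) (E : Finset ℕ+) (x : T θ F) :
    coord θ F k (projT θ F E x) = if k ∈ E then coord θ F k x else 0 := by
  simp [projT_apply, coord_e]

theorem projT_projT (E E' : Finset ℕ+) (x : T θ F) :
    projT θ F E (projT θ F E' x) = projT θ F (E ∩ E') x := by
  rw [projT_apply E, projT_apply (E ∩ E'), ← Finset.filter_mem_eq_inter, Finset.sum_filter]
  refine Finset.sum_congr rfl fun k _ => ?_
  rw [coord_projT]
  split_ifs <;> simp

theorem norm_projT_le (E : Finset ℕ+) (x : T θ F) : ‖projT θ F E x‖ ≤ ‖x‖ := by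
  refine denseRange_emb.induction_on x (isClosed_le (by fun_prop) (by fun_prop)) fun y => ?_
  rw [projT_emb, norm_emb, norm_emb]
  exact tsNorm_proj_le θ.2.1.le (coe_le_one θ) F E y

theorem norm_projT_mono {E E' : Finset ℕ+} (h : E ⊆ E') (x : T θ F) :
    ‖projT θ F E x‖ ≤ ‖projT θ F E' x‖ := by
  have := norm_projT_le E (projT θ F E' x)
  rwa [projT_projT, Finset.inter_eq_left.2 h] at this

theorem norm_e (i : ℕ+) : ‖e θ F i‖ = 1 := by
  refine le_antisymm ?_ ?_
  · rw [← emb_single, norm_emb]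
    refine (tsNorm_le_l1 (coe_le_one θ) F _).trans ?_
    simp [l1]
  · have := abs_coord_le i (e θ F i)
    simpa [coord_e] using this

theorem norm_projT_singleton (k : ℕ+) (x : T θ F) : ‖projT θ F {k} x‖ = |coord θ F k x| := by
  rw [projT_apply, Finset.sum_singleton, norm_smul, norm_e, mul_one, Real.norm_eq_abs]

theorem admissible_sum_le_norm {d : ℕ} {E : Fin d → Finset ℕ+} (hE : IsAdmissible F E)
    (x : T θ F) : θ * ∑ k, ‖projT θ F (E k) x‖ ≤ ‖x‖ := by
  refine denseRange_emb.induction_on x (isClosed_le (by fun_prop) (by fun_prop)) fun y => ?_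
  simp only [projT_emb, norm_emb]
  exact admissible_sum_le_tsNorm (coe_le_one θ) hE y

/-- Perturbation to a finitely supported `y`: the error `z` changes every admissible sum by at most
`‖z‖`, uniformly in `E`, by `admissible_sum_le_norm`. -/
theorem norm_le_of_admissible {x : T θ F} {a : ℝ} (hx : ∀ k, |coord θ F k x| ≤ a)
    (hE : ∀ (d : ℕ) (E : Fin d → Finset ℕ+), IsAdmissible F E →
      θ * ∑ k, ‖projT θ F (E k) x‖ ≤ a) : ‖x‖ ≤ a := by
  have h0 : (0 : ℝ) ≤ θ := θ.2.1.le
  refine le_of_forall_pos_le_add fun η hη => ?_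
  obtain ⟨y, hy⟩ := denseRange_emb.exists_dist_lt (f := emb θ F) x (half_pos hη)
  rw [dist_eq_norm, ← norm_neg, neg_sub] at hy
  set z := emb θ F y - x with hz
  have hyz : emb θ F y = x + z := by rw [hz]; abel
  have hnorm : tsNorm θ F y ≤ a + η / 2 := by
    refine tsNorm_le h0 (coe_le_one θ) (fun k => ?_) fun d E hadm => ?_
    · rw [← coord_emb (θ := θ) (F := F), hyz, map_add]
      exact (abs_add_le _ _).trans (add_le_add (hx k) ((abs_coord_le k z).trans hy.le))
    · simp only [← norm_emb, ← projT_emb, hyz, map_add]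
      calc (θ : ℝ) * ∑ k, ‖projT θ F (E k) x + projT θ F (E k) z‖
          ≤ θ * ∑ k, (‖projT θ F (E k) x‖ + ‖projT θ F (E k) z‖) := by
            gcongr
            exact norm_add_le _ _
        _ = θ * ∑ k, ‖projT θ F (E k) x‖ + θ * ∑ k, ‖projT θ F (E k) z‖ := by
            rw [Finset.sum_add_distrib, mul_add]
        _ ≤ a + η / 2 :=
            add_le_add (hE d E hadm) ((admissible_sum_le_norm hadm z).trans hy.le)
  calc ‖x‖ = ‖emb θ F y - z‖ := by rw [hz]; congr 1; abel
    _ ≤ ‖emb θ F y‖ + ‖z‖ := norm_sub_le _ _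
    _ ≤ a + η / 2 + η / 2 := add_le_add (norm_emb (θ := θ) (F := F) y ▸ hnorm) hy.le
    _ = a + η := by ring

/-- The projection of `x` to the coordinates `≥ m`. -/
def tail (m : ℕ+) (x : T θ F) : T θ F := x - projT θ F (Finset.Iio m) x

theorem coord_tail (k m : ℕ+) (x : T θ F) :
    coord θ F k (tail m x) = if m ≤ k then coord θ F k x else 0 := by
  rw [tail, map_sub, coord_projT]
  rcases lt_or_ge k m with h | h
  · simp [h, not_le.2 h]
  · simp [h, not_lt.2 h]

theorem norm_tail_le (m : ℕ+) (x : T θ F) : ‖tail m x‖ ≤ ‖x‖ := by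
  unfold tail
  refine denseRange_emb.induction_on x (isClosed_le (by fun_prop) (by fun_prop)) fun y => ?_
  rw [projT_emb, ← map_sub, norm_emb, norm_emb]
  refine tsNorm_le_of_abs_le θ.2.1.le (coe_le_one θ) F fun i => ?_
  rw [Finsupp.sub_apply, proj_apply]
  split_ifs <;> simp

theorem projT_tail_comm (E : Finset ℕ+) (m : ℕ+) (x : T θ F) :
    projT θ F E (tail m x) = tail m (projT θ F E x) := by
  rw [tail, tail, map_sub, projT_projT, projT_projT, Finset.inter_comm]

theorem norm_projT_tail_le (E : Finset ℕ+) (m : ℕ+) (x : T θ F) :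
    ‖projT θ F E (tail m x)‖ ≤ ‖projT θ F E x‖ := by
  rw [projT_tail_comm]
  exact norm_tail_le m _

theorem projT_congr {E : Finset ℕ+} {x y : T θ F} (h : ∀ k ∈ E, coord θ F k x = coord θ F k y) :
    projT θ F E x = projT θ F E y := by
  rw [projT_apply, projT_apply]
  exact Finset.sum_congr rfl fun k hk => by rw [h k hk]

theorem norm_projT_le_norm_tail {E : Finset ℕ+} {m : ℕ+} (h : ∀ k ∈ E, m ≤ k) (x : T θ F) :
    ‖projT θ F E x‖ ≤ ‖tail m x‖ := by
  rw [projT_congr (y := tail m x) fun k hk => by rw [coord_tail, if_pos (h k hk)]]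
  exact norm_projT_le _ _

/-- Tails are contractive and eventually vanish on the dense set of finitely supported vectors. -/
theorem exists_norm_tail_lt (x : T θ F) {η : ℝ} (hη : 0 < η) :
    ∃ m₀ : ℕ+, ∀ m, m₀ ≤ m → ‖tail m x‖ < η := by
  obtain ⟨y, hy⟩ := denseRange_emb.exists_dist_lt (f := emb θ F) x hη
  rw [dist_eq_norm] at hy
  obtain ⟨m₀, hm₀⟩ := y.support.bddAbove
  refine ⟨m₀ + 1, fun m hm => ?_⟩
  have hzero : tail m (emb θ F y) = 0 := by
    rw [tail, projT_emb, ← map_sub, ← map_zero (emb θ F)]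
    congr 1
    ext k
    rw [Finsupp.sub_apply, proj_apply, Finsupp.zero_apply]
    split_ifs with hk
    · exact sub_self _
    · rw [sub_zero]
      by_contra hne
      have h2 : k ≤ m₀ := hm₀ (Finsupp.mem_support_iff.2 hne)
      rw [Finset.mem_Iio] at hk
      exact hk ((PNat.lt_add_one_iff.2 h2).trans_le hm)
  have hsub : tail m x = tail m (x - emb θ F y) := by
    have : tail m (x - emb θ F y) = tail m x - tail m (emb θ F y) := by
      simp only [tail, map_sub]
      abel
    rw [this, hzero, sub_zero]
  rw [hsub]
  exact (norm_tail_le m _).trans_lt hy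

theorem abs_coord_le_norm_tail (k : ℕ+) (x : T θ F) : |coord θ F k x| ≤ ‖tail k x‖ := by
  have := abs_coord_le k (tail k x)
  rwa [coord_tail, if_pos le_rfl] at this

theorem ext_coord {x y : T θ F} (h : ∀ k, coord θ F k x = coord θ F k y) : x = y := by
  rw [← sub_eq_zero, ← norm_le_zero_iff]
  refine le_of_forall_pos_le_add fun η hη => ?_
  obtain ⟨m, hm⟩ := exists_norm_tail_lt (x - y) hη
  have h0 : tail m (x - y) = x - y := by
    rw [tail, map_sub, projT_congr fun k _ => h k, sub_self, sub_zero]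
  have := hm m le_rfl
  rw [h0] at this
  linarith

end Completion

/-! ### Weak nullity, and norm-one vectors orthogonal to far vectors. -/

section Schreier

variable {θ : Set.Ioc (0 : ℝ) (1 / 2)}

/-- The singletons of `A`, in increasing order, form an admissible sequence. -/
theorem sum_abs_coord_le (x : T θ schreierOne) {A : Finset ℕ+}
    (hA : ∀ k ∈ A, A.card ≤ (k : ℕ)) : θ * ∑ k ∈ A, |coord θ schreierOne k x| ≤ ‖x‖ := by
  rcases A.eq_empty_or_nonempty with rfl | hne
  · simp
  have hE : IsAdmissible schreierOne fun i => {A.orderEmbOfFin rfl i} := by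
    refine isAdmissible_schreierOne_iff.2 ⟨hne.card_pos, ⟨fun i => by simp, ?_⟩, ?_⟩
    · intro i j hij p hp q hq
      rw [Finset.mem_singleton] at hp hq
      subst hp hq
      exact (A.orderEmbOfFin rfl).lt_iff_lt.2 hij
    · intro i p hp
      rw [Finset.mem_singleton] at hp
      subst hp
      exact hA _ (A.orderEmbOfFin_mem rfl i)
  refine le_trans (le_of_eq ?_) (admissible_sum_le_norm hE x)
  congr 1
  simp only [norm_projT_singleton]
  have := Finset.sum_map Finset.univ (A.orderEmbOfFin rfl).toEmbedding
    fun k => |coord θ schreierOne k x|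
  rwa [Finset.map_orderEmbOfFin_univ] at this

/-- The unit vector basis is weakly null. -/
theorem finite_le_abs_apply_e (f : T θ schreierOne →L[ℝ] ℝ) {δ : ℝ} (hδ : 0 < δ) :
    {j | δ ≤ |f (e θ schreierOne j)|}.Finite := by
  by_contra hinf
  set L := {j | δ ≤ |f (e θ schreierOne j)|} with hL
  have hpos : 0 < δ / (‖f‖ + 1) := by positivity
  obtain ⟨x, hx, hlt⟩ := exists_combos_tsNorm_lt θ.2.1.le θ.2.2 (L := L) hinf hpos
  -- Changing signs by `D` makes `f` at least `δ` on all of `combos L 0`, and unconditionality keeps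
  -- the norm under control.
  set D : (ℕ+ →₀ ℝ) →ₗ[ℝ] (ℕ+ →₀ ℝ) := Finsupp.lsum ℝ fun j =>
    (SignType.sign (f (e θ schreierOne j)) : ℝ) • Finsupp.lsingle j with hD
  set φ : (ℕ+ →₀ ℝ) →ₗ[ℝ] ℝ := f.toLinearMap ∘ₗ emb θ schreierOne ∘ₗ D with hφ
  have hφx : δ ≤ φ x := by
    refine convexHull_min (t := {x | δ ≤ φ x}) ?_ ?_ hx
    · rintro _ ⟨j, ⟨hj, -⟩, rfl⟩
      have : φ (Finsupp.single j 1) = |f (e θ schreierOne j)| := by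
        simp only [hφ, hD, LinearMap.comp_apply, Finsupp.lsum_single, LinearMap.smul_apply,
          Finsupp.lsingle_apply, map_smul, emb_single, ContinuousLinearMap.coe_coe, smul_eq_mul,
          sign_mul_self]
      exact hj.trans_eq this.symm
    · exact (convex_Ici δ).is_linear_preimage φ.isLinear
  have hDx : ∀ k, |D x k| ≤ |x k| := fun k => by
    have : Finsupp.lapply k ∘ₗ D =
        (SignType.sign (f (e θ schreierOne k)) : ℝ) • Finsupp.lapply k := by
      refine Finsupp.lhom_ext fun j a => ?_
      by_cases hjk : j = k
      · subst hjk
        simp [hD]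
      · simp [hD, Finsupp.single_eq_of_ne' hjk]
    have hk : D x k = (SignType.sign (f (e θ schreierOne k)) : ℝ) * x k := by
      simpa using LinearMap.congr_fun this x
    rw [hk, abs_mul]
    refine mul_le_of_le_one_left (abs_nonneg _) ?_
    rcases SignType.sign (f (e θ schreierOne k)) <;> simp
  have hle : φ x ≤ ‖f‖ * tsNorm θ schreierOne x := by
    refine (le_abs_self _).trans ((f.le_opNorm _).trans ?_)
    rw [LinearMap.comp_apply, norm_emb]
    exact mul_le_mul_of_nonneg_left
      (tsNorm_le_of_abs_le θ.2.1.le (coe_le_one θ) _ hDx) (norm_nonneg f)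
  rw [lt_div_iff₀ (by positivity)] at hlt
  have := tsNorm_nonneg (coe_le_one θ) schreierOne x
  linarith

/-- If adding suitable far vectors of norm one to `x` gives norm at most one, then an admissible
sequence without its last set contributes at most `1 - θ` to the norm of `x`. -/
theorem sum_castSucc_le {x : T θ schreierOne}
    (hv : ∀ (η : ℝ) (m : ℕ+), 0 < η → ∃ v : T θ schreierOne, ‖v‖ = 1 ∧ ‖x + v‖ ≤ 1 ∧
      ‖projT θ schreierOne (Finset.Iic m) v‖ < η)
    {d : ℕ} {E : Fin (d + 1) → Finset ℕ+} (hE : IsAdmissible schreierOne E) :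
    θ * ∑ k : Fin d, ‖projT θ schreierOne (E k.castSucc) x‖ ≤ 1 - θ := by
  have h0 : (0 : ℝ) < θ := θ.2.1
  -- The error `d + 3` counts `d` for `v` on the first `d` sets, two for the head and tail of `v`
  -- outside `I`, and one for `x` on `I`.
  have hsmall : ∀ η : ℝ, 0 < η →
      θ * ∑ k : Fin d, ‖projT θ schreierOne (E k.castSucc) x‖ ≤ 1 - θ + (θ * (d + 3)) * η := by
    intro η hη
    obtain ⟨hd, hEc, hmin⟩ := isAdmissible_schreierOne_iff.1 hE
    obtain ⟨m₀, hm₀⟩ := exists_norm_tail_lt x hη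
    obtain ⟨m₁, hm₁⟩ := (Finset.univ.biUnion E).bddAbove
    set m := max m₀ m₁ with hm
    have hEm : ∀ k, ∀ p ∈ E k, p ≤ m := fun k p hp =>
      (hm₁ (Finset.mem_biUnion.2 ⟨k, Finset.mem_univ k, hp⟩)).trans (le_max_right _ _)
    obtain ⟨v, hv1, hxv, hvm⟩ := hv η m hη
    obtain ⟨n₀, hn₀⟩ := exists_norm_tail_lt v hη
    set n := max n₀ m with hn
    set I := Finset.Ioc m n with hI
    have hIlt : ∀ p ∈ I, m < p := fun p hp => (Finset.mem_Ioc.1 hp).1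
    -- Enlarging the last set to the right alters neither the number of sets nor their minima, so
    -- admissibility survives while almost all of `v` is captured.
    set E' : Fin (d + 1) → Finset ℕ+ := Fin.snoc (fun k : Fin d => E k.castSucc)
      (E (Fin.last d) ∪ I) with hE'
    have hE'c : ∀ k : Fin d, E' k.castSucc = E k.castSucc := fun k => by simp [hE']
    have hE'l : E' (Fin.last d) = E (Fin.last d) ∪ I := by simp [hE']
    have hadm : IsAdmissible schreierOne E' := by
      refine isAdmissible_schreierOne_iff.2 ⟨hd, ⟨fun k => ?_, fun i j hij p hp q hq => ?_⟩, ?_⟩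
      · refine Fin.lastCases ?_ (fun k => ?_) k
        · rw [hE'l]
          exact (hEc.nonempty _).mono Finset.subset_union_left
        · rw [hE'c]
          exact hEc.nonempty _
      · induction i using Fin.lastCases with
        | last => exact absurd hij (not_lt.2 (Fin.le_last j))
        | cast i =>
          rw [hE'c] at hp
          induction j using Fin.lastCases with
          | last =>
            rw [hE'l, Finset.mem_union] at hq
            rcases hq with hq | hq
            · exact hEc.lt _ _ hij p hp q hq
            · exact (hEm _ p hp).trans_lt (hIlt q hq)
          | cast j =>
            rw [hE'c] at hq
            exact hEc.lt _ _ hij p hp q hq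
      · intro k p hp
        induction k using Fin.lastCases with
        | last =>
          rw [hE'l, Finset.mem_union] at hp
          rcases hp with hp | hp
          · exact hmin _ p hp
          · obtain ⟨q, hq⟩ := hEc.nonempty (Fin.last d)
            have h2 : (q : ℕ) ≤ p := (hEm _ q hq).trans (hIlt p hp).le
            exact (hmin _ q hq).trans h2
        | cast k =>
          rw [hE'c] at hp
          exact hmin _ p hp
    have hsum := (admissible_sum_le_norm hadm (x + v)).trans hxv
    rw [Fin.sum_univ_castSucc] at hsum
    simp only [hE'c, hE'l] at hsum
    have hfirst : ∑ k : Fin d, ‖projT θ schreierOne (E k.castSucc) x‖ - d * η ≤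
        ∑ k : Fin d, ‖projT θ schreierOne (E k.castSucc) (x + v)‖ := by
      have : ∑ _k : Fin d, η = d * η := by simp
      rw [← this, ← Finset.sum_sub_distrib]
      refine Finset.sum_le_sum fun k _ => ?_
      have h2 : ‖projT θ schreierOne (E k.castSucc) v‖ ≤ η :=
        (norm_projT_mono (fun p hp => Finset.mem_Iic.2 (hEm _ p hp)) v).trans hvm.le
      have h3 := norm_sub_norm_le (projT θ schreierOne (E k.castSucc) x)
        (-projT θ schreierOne (E k.castSucc) v)
      rw [norm_neg, sub_neg_eq_add, ← map_add] at h3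
      linarith
    have hlast : 1 - 3 * η ≤ ‖projT θ schreierOne (E (Fin.last d) ∪ I) (x + v)‖ := by
      refine le_trans ?_ (norm_projT_mono Finset.subset_union_right (x + v))
      have hIx : ‖projT θ schreierOne I x‖ < η :=
        (norm_projT_le_norm_tail (fun p hp => (hIlt p hp).le) x).trans_lt
          (hm₀ m (le_max_left _ _))
      have hvt : ‖tail (n + 1) v‖ < η :=
        hn₀ _ ((le_max_left _ _).trans (PNat.lt_add_one_iff.2 le_rfl).le)
      have hdecomp : v = projT θ schreierOne (Finset.Iic m) v + projT θ schreierOne I v +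
          tail (n + 1) v := by
        refine ext_coord fun k => ?_
        simp only [map_add, coord_projT, coord_tail, hI, Finset.mem_Iic, Finset.mem_Ioc]
        have hmn : m ≤ n := le_max_right _ _
        rcases le_or_gt k m with h2 | h2
        · have h3 : ¬ n + 1 ≤ k := not_le.2 (PNat.lt_add_one_iff.2 (h2.trans hmn))
          simp [h2, not_lt.2 h2, h3]
        · rcases le_or_gt k n with h3 | h3
          · have h4 : ¬ n + 1 ≤ k := not_le.2 (PNat.lt_add_one_iff.2 h3)
            simp [h2, h3, not_le.2 h2, h4]
          · have h4 : n + 1 ≤ k := PNat.add_one_le_iff.2 h3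
            simp [not_le.2 h2, not_le.2 h3, h4]
      have hIv : 1 - 2 * η ≤ ‖projT θ schreierOne I v‖ := by
        have h2 : ‖v‖ ≤ ‖projT θ schreierOne (Finset.Iic m) v‖ + ‖projT θ schreierOne I v‖ +
            ‖tail (n + 1) v‖ := by
          conv_lhs => rw [hdecomp]
          exact norm_add₃_le
        linarith
      have h3 := norm_sub_norm_le (projT θ schreierOne I v) (-projT θ schreierOne I x)
      rw [norm_neg, sub_neg_eq_add, ← map_add, add_comm v x] at h3
      linarith
    have h4 := mul_le_mul_of_nonneg_left (add_le_add hfirst hlast) h0.le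
    linarith
  by_contra! hcon
  have hpos : (0 : ℝ) < θ * (d + 3) := by positivity
  have := hsmall ((θ * ∑ k : Fin d, ‖projT θ schreierOne (E k.castSucc) x‖ - (1 - θ)) /
    (2 * (θ * (d + 3)))) (div_pos (by linarith) (by positivity))
  rw [mul_div_assoc', mul_comm (2 : ℝ), mul_div_mul_left _ _ hpos.ne'] at this
  linarith

/-- Coordinates tend to zero, so only finitely many exceed `1 / 2`. -/
theorem exists_abs_coord_le_lt_one {x : T θ schreierOne}
    (hx : ∀ k, |coord θ schreierOne k x| < 1) :
    ∃ a < 1, ∀ k, |coord θ schreierOne k x| ≤ a := by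
  obtain ⟨m, hm⟩ := exists_norm_tail_lt x (half_pos one_pos)
  obtain ⟨k, -, hk⟩ := (Finset.Iic m).exists_max_image (fun k => |coord θ schreierOne k x|)
    ⟨m, Finset.mem_Iic.2 le_rfl⟩
  refine ⟨max (1 / 2) |coord θ schreierOne k x|, max_lt (by norm_num) (hx k), fun j => ?_⟩
  rcases le_or_gt j m with hj | hj
  · exact (hk j (Finset.mem_Iic.2 hj)).trans (le_max_right _ _)
  · exact ((abs_coord_le_norm_tail j x).trans (hm j hj.le).le).trans (le_max_left _ _)

/-- A norm-one vector that is `ℓ_∞`-orthogonal to far vectors of norm one attains its norm at a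
coordinate. -/
theorem exists_abs_coord_eq_one {x : T θ schreierOne} (hx : ‖x‖ = 1)
    (hv : ∀ (η : ℝ) (m : ℕ+), 0 < η → ∃ v : T θ schreierOne, ‖v‖ = 1 ∧ ‖x + v‖ ≤ 1 ∧
      ‖projT θ schreierOne (Finset.Iic m) v‖ < η) :
    ∃ k, |coord θ schreierOne k x| = 1 := by
  have h0 : (0 : ℝ) < θ := θ.2.1
  by_contra! hne
  have hlt : ∀ k, |coord θ schreierOne k x| < 1 := fun k =>
    lt_of_le_of_ne ((abs_coord_le k x).trans_eq hx) (hne k)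
  obtain ⟨a, ha1, ha⟩ := exists_abs_coord_le_lt_one hlt
  -- `M` is the last index whose removal matters: a nearly norming sequence for `tail M x` must
  -- depend on coordinate `M`.
  obtain ⟨M, hM, hM1⟩ : ∃ M : ℕ+, 1 ≤ ‖tail M x‖ ∧ ‖tail (M + 1) x‖ < 1 := by
    by_contra! hcon
    have hall : ∀ M : ℕ+, 1 ≤ ‖tail M x‖ := fun M => by
      induction M using PNat.recOn with
      | one =>
        have : tail 1 x = x := ext_coord fun k => by rw [coord_tail, if_pos (one_le)]
        rw [this, hx]
      | succ M ih => exact hcon M ih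
    obtain ⟨m, hm⟩ := exists_norm_tail_lt x one_pos
    exact absurd (hm m le_rfl) (not_lt.2 (hall m))
  set w := tail M x with hw
  have hw1 : ‖w‖ ≤ 1 := (norm_tail_le M x).trans_eq hx
  set t := ‖tail (M + 1) x‖ with ht
  -- The three terms rule out, in turn, norming by a coordinate, by a single set (`θ ≤ 1 / 2 < 1 - 1
  -- / 4`), and by a sum of at most `1 - θ + θ t`.
  set δ := min (1 - a) (min (1 / 4) (θ * (1 - t))) with hδ
  have hδpos : 0 < δ :=
    lt_min (by linarith) (lt_min (by norm_num) (mul_pos h0 (by linarith)))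
  obtain ⟨d, E, hE, hsum⟩ : ∃ (d : ℕ) (E : Fin d → Finset ℕ+), IsAdmissible schreierOne E ∧
      1 - δ < θ * ∑ k, ‖projT θ schreierOne (E k) w‖ := by
    by_contra! hcon
    have : ‖w‖ ≤ 1 - δ := by
      refine norm_le_of_admissible (fun k => ?_) hcon
      have h2 : a ≤ 1 - δ := by
        have := min_le_left (1 - a) (min (1 / 4) (θ * (1 - t)))
        linarith
      refine le_trans ?_ h2
      rw [hw, coord_tail]
      split_ifs
      · exact ha k
      · rw [abs_zero]
        exact (abs_nonneg _).trans (ha 1)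
    linarith
  obtain _ | d := d
  · exact absurd hE.1 (lt_irrefl 0)
  rw [Fin.sum_univ_castSucc] at hsum
  -- If the last set contains `M`, the earlier ones lie before `M`, where `w` vanishes. Otherwise
  -- the last set sees only `tail (M + 1) x`, and `sum_castSucc_le` bounds the rest.
  by_cases hMl : M ∈ E (Fin.last d)
  · have hz : ∀ k : Fin d, projT θ schreierOne (E k.castSucc) w = 0 := fun k => by
      rw [projT_apply]
      refine Finset.sum_eq_zero fun p hp => ?_
      have hpM : p < M := hE.2.choose.lt _ _ (Fin.castSucc_lt_last k) p hp M hMl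
      rw [hw, coord_tail, if_neg (not_le.2 hpM), zero_smul]
    simp only [hz, norm_zero, Finset.sum_const_zero, zero_add] at hsum
    have h2 : ‖projT θ schreierOne (E (Fin.last d)) w‖ ≤ 1 := (norm_projT_le _ w).trans hw1
    have h3 : δ ≤ 1 / 4 := (min_le_right _ _).trans (min_le_left _ _)
    have h4 := mul_le_mul_of_nonneg_left h2 h0.le
    have h5 := θ.2.2
    linarith
  · have hl : ‖projT θ schreierOne (E (Fin.last d)) w‖ ≤ t := by
      rw [projT_congr (y := tail (M + 1) x)]
      · exact norm_projT_le _ _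
      · intro k hk
        rw [hw, coord_tail, coord_tail]
        have hkM : k ≠ M := fun h => hMl (h ▸ hk)
        have : M ≤ k ↔ M + 1 ≤ k :=
          ⟨fun h => PNat.add_one_le_iff.2 (lt_of_le_of_ne h hkM.symm),
            fun h => (PNat.add_one_le_iff.1 h).le⟩
        simp only [this]
    have hfirst : θ * ∑ k : Fin d, ‖projT θ schreierOne (E k.castSucc) w‖ ≤ 1 - θ :=
      (mul_le_mul_of_nonneg_left
        (Finset.sum_le_sum fun k _ => norm_projT_tail_le _ M x) h0.le).trans
        (sum_castSucc_le hv hE)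
    have h3 : δ ≤ θ * (1 - t) := (min_le_right _ _).trans (min_le_right _ _)
    have h4 := mul_le_mul_of_nonneg_left hl h0.le
    linarith

end Schreier

/-! ### Injections of the positive integers that do not move points far to the right. -/

section Combinatorics

/-- For `M ≥ N`, the finite set `{1, …, M}` is mapped injectively into itself. -/
theorem surjOn_of_le_max {N : ℕ} {π : ℕ+ → ℕ+} (hinj : Function.Injective π)
    (hle : ∀ i, (π i : ℕ) ≤ max (i : ℕ) N) {M : ℕ} (hM : N ≤ M) {k : ℕ+} (hk : (k : ℕ) ≤ M) :
    ∃ i : ℕ+, (i : ℕ) ≤ M ∧ π i = k := by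
  rcases Nat.eq_zero_or_pos M with rfl | hpos
  · exact absurd k.pos (not_lt.2 hk)
  let m : ℕ+ := ⟨M, hpos⟩
  have hmaps : Set.MapsTo π (Finset.Iic m) (Finset.Iic m) := fun i hi => by
    have hi' : i ≤ m := Finset.mem_Iic.1 (Finset.mem_coe.1 hi)
    exact Finset.mem_coe.2 (Finset.mem_Iic.2 (show (π i : ℕ) ≤ M from
      (hle i).trans (max_le hi' hM)))
  obtain ⟨i, hi, hik⟩ := Finset.surjOn_of_injOn_of_card_le π hmaps hinj.injOn le_rfl
    (Finset.mem_coe.2 (Finset.mem_Iic.2 (show k ≤ m from hk)))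
  have hi' : i ≤ m := Finset.mem_Iic.1 (Finset.mem_coe.1 hi)
  exact ⟨i, hi', hik⟩

theorem surjective_of_le_max {N : ℕ} {π : ℕ+ → ℕ+} (hinj : Function.Injective π)
    (hle : ∀ i, (π i : ℕ) ≤ max (i : ℕ) N) : Function.Surjective π := fun k =>
  (surjOn_of_le_max hinj hle (le_max_right (k : ℕ) N) (le_max_left _ _)).imp fun _ h => h.2

/-- As `i - 1 ≥ N`, the values below `i` are already taken by the indices below `i`. -/
theorem eq_self_of_le_max {N : ℕ} {π : ℕ+ → ℕ+} (hinj : Function.Injective π)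
    (hle : ∀ i, (π i : ℕ) ≤ max (i : ℕ) N) {i : ℕ+} (hi : N < (i : ℕ)) : π i = i := by
  by_contra hne
  have h1 : (π i : ℕ) ≤ i := (hle i).trans_eq (max_eq_left hi.le)
  have h2 : (π i : ℕ) ≠ i := fun h => hne (PNat.eq h)
  obtain ⟨p, hp, hpi⟩ := surjOn_of_le_max hinj hle (M := (i : ℕ) - 1) (k := π i)
    (by lia) (by lia)
  have := i.pos
  rw [hinj hpi] at hp
  lia

end Combinatorics

/-! ### Images of unit vectors under isometries, and the converse. -/

section Isometry

variable {θ : Set.Ioc (0 : ℝ) (1 / 2)}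

theorem emb_ones (F : Set (Finset ℕ+)) (A : Finset ℕ+) :
    emb θ F (ones A) = ∑ i ∈ A, e θ F i := by
  simp only [← emb_single, ← map_sum]
  congr 1
  ext k
  simp [ones_apply, Finsupp.single_apply]

theorem norm_e_add_smul_e_le (F : Set (Finset ℕ+)) {i j : ℕ+} (hij : i ≠ j) {c : ℝ}
    (hc : |c| ≤ 1) : ‖e θ F i + c • e θ F j‖ ≤ 1 := by
  have h0 : (0 : ℝ) ≤ θ := θ.2.1.le
  rw [← emb_single, ← emb_single, ← map_smul, ← map_add, norm_emb]
  refine (tsNorm_le_of_abs_le h0 (coe_le_one θ) F (y := ones {i, j}) fun k => ?_).trans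
    ((tsNorm_ones_le h0 (coe_le_one θ) F _).trans ?_)
  · rw [ones_apply, Finsupp.add_apply, Finsupp.smul_apply, Finsupp.single_apply,
      Finsupp.single_apply]
    by_cases hi : i = k
    · subst hi
      simp [hij.symm]
    · by_cases hj : j = k
      · subst hj
        simp [hij, hc]
      · simp [hi, hj]
  · rw [Finset.card_pair hij]
    have := θ.2.2
    refine max_le le_rfl ?_
    push_cast
    linarith

variable {U : T θ schreierOne →L[ℝ] T θ schreierOne}

/-- Supplies the hypothesis of `exists_abs_coord_eq_one`: weak nullity, applied to the functionals
`coord k ∘ U` with `k ≤ m`, leaves only finitely many unsuitable `j`. -/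
theorem exists_far_image (hU : ∀ x, ‖U x‖ = ‖x‖) (i : ℕ+) (η : ℝ) (m : ℕ+) (hη : 0 < η) :
    ∃ v : T θ schreierOne, ‖v‖ = 1 ∧ ‖U (e θ schreierOne i) + v‖ ≤ 1 ∧
      ‖projT θ schreierOne (Finset.Iic m) v‖ < η := by
  have hcard : (0 : ℝ) < (Finset.Iic m).card := by
    exact_mod_cast Finset.card_pos.2 ⟨m, Finset.mem_Iic.2 le_rfl⟩
  set η' := η / (2 * (Finset.Iic m).card) with hη'
  have hη'pos : 0 < η' := by positivity
  have hfin : (⋃ k ∈ Finset.Iic m,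
      {j | η' ≤ |coord θ schreierOne k (U (e θ schreierOne j))|}).Finite :=
    (Finset.Iic m).finite_toSet.biUnion fun k _ =>
      finite_le_abs_apply_e ((coord θ schreierOne k).comp U) hη'pos
  obtain ⟨j, hj⟩ := (hfin.union (Set.finite_singleton i)).exists_notMem
  rw [Set.mem_union, not_or] at hj
  obtain ⟨hj, hji⟩ := hj
  refine ⟨U (e θ schreierOne j), by rw [hU, norm_e], ?_, ?_⟩
  · have := norm_e_add_smul_e_le (θ := θ) schreierOne (Ne.symm hji) (c := 1) (by simp)
    rwa [one_smul, ← hU, map_add] at this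
  · rw [projT_apply]
    refine (norm_sum_le _ _).trans_lt ?_
    calc _ ≤ ∑ _k ∈ Finset.Iic m, η' := by
          refine Finset.sum_le_sum fun k hk => ?_
          rw [norm_smul, norm_e, mul_one, Real.norm_eq_abs]
          by_contra! hcon
          exact hj (Set.mem_biUnion hk hcon.le)
      _ = η / 2 := by
          rw [Finset.sum_const, nsmul_eq_mul, hη']
          field_simp
      _ < η := half_lt_self hη

/-- A coordinate of modulus one leaves no room for another term, since `‖e_i ± e_j‖ ≤ 1`. -/
theorem coord_eq_zero_of_abs_coord_eq_one (hU : ∀ x, ‖U x‖ = ‖x‖) {i j k : ℕ+} (hij : i ≠ j)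
    (hk : |coord θ schreierOne k (U (e θ schreierOne i))| = 1) :
    coord θ schreierOne k (U (e θ schreierOne j)) = 0 := by
  have hb : ∀ c : ℝ, |c| ≤ 1 → |coord θ schreierOne k (U (e θ schreierOne i)) +
      c * coord θ schreierOne k (U (e θ schreierOne j))| ≤ 1 := fun c hc => by
    have := (abs_coord_le k (U (e θ schreierOne i + c • e θ schreierOne j))).trans_eq (hU _)
    rw [map_add, map_add, map_smul, map_smul, smul_eq_mul] at this
    exact this.trans (norm_e_add_smul_e_le schreierOne hij hc)
  have h1 := abs_le.1 (hb 1 (by simp))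
  have h2 := abs_le.1 (hb (-1) (by simp))
  rcases eq_or_eq_neg_of_abs_eq hk with h | h <;> rw [h] at h1 h2 <;> linarith

theorem index_le_max (hU : ∀ x, ‖U x‖ = ‖x‖) {π : ℕ+ → ℕ+} (hinj : Function.Injective π)
    (hπ : ∀ i, |coord θ schreierOne (π i) (U (e θ schreierOne i))| = 1)
    (hπ0 : ∀ i j, i ≠ j → coord θ schreierOne (π i) (U (e θ schreierOne j)) = 0) (i : ℕ+) :
    (π i : ℕ) ≤ max (i : ℕ) ⌊(θ : ℝ)⁻¹⌋₊ := by
  have h0 : (0 : ℝ) < θ := θ.2.1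
  by_contra! hcon
  set m := max (i : ℕ) ⌊(θ : ℝ)⁻¹⌋₊ with hm
  have hfin : {j : ℕ+ | (π j : ℕ) ≤ m}.Finite := by
    refine Set.Finite.preimage (f := fun j => (π j : ℕ)) (s := Set.Iic m) ?_ (Set.finite_Iic m)
    exact (PNat.coe_injective.comp hinj).injOn
  obtain ⟨B, hB, hBcard⟩ :=
    (hfin.union (Set.finite_singleton i)).infinite_compl.exists_subset_card_eq m
  have hiB : i ∉ B := fun h => hB h (Or.inr rfl)
  set A := insert i B with hA
  have hAcard : A.card = m + 1 := by rw [hA, Finset.card_insert_of_notMem hiB, hBcard]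
  have hAπ : ∀ j ∈ A, m < (π j : ℕ) := fun j hj => by
    rcases Finset.mem_insert.1 hj with rfl | hj
    · exact hcon
    · by_contra! h
      exact hB hj (Or.inl h)
  have hcoord : ∀ j ∈ A,
      |coord θ schreierOne (π j) (U (∑ l ∈ A, e θ schreierOne l))| = 1 := fun j hj => by
    rw [map_sum, map_sum, Finset.sum_eq_single j]
    · exact hπ j
    · exact fun l _ hl => hπ0 j l hl.symm
    · exact fun h => absurd hj h
  -- The image of `A` has `m + 1` points, all at least `m + 1`: exactly the Schreier condition.
  have hlow := sum_abs_coord_le (U (∑ l ∈ A, e θ schreierOne l)) (A := A.image π) (by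
    intro k hk
    obtain ⟨j, hj, rfl⟩ := Finset.mem_image.1 hk
    rw [Finset.card_image_of_injective _ hinj, hAcard]
    exact hAπ j hj)
  rw [Finset.sum_image hinj.injOn, Finset.sum_congr rfl hcoord, hU, ← emb_ones, norm_emb,
    Finset.sum_const, nsmul_eq_mul, mul_one, hAcard] at hlow
  have hup := tsNorm_ones_insert_le h0.le θ.2.2 (le_max_left (i : ℕ) ⌊(θ : ℝ)⁻¹⌋₊) hBcard.le
  have hone : 1 < θ * ((m : ℝ) + 1) := by
    have h2 : (θ : ℝ)⁻¹ < m + 1 := (Nat.lt_floor_add_one _).trans_le (by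
      have : ((⌊(θ : ℝ)⁻¹⌋₊ : ℕ) : ℝ) ≤ m := by exact_mod_cast le_max_right _ _
      linarith)
    rwa [inv_lt_iff_one_lt_mul₀' h0] at h2
  push_cast at hlow
  rcases le_max_iff.1 (hlow.trans hup) with h | h
  · linarith
  · linarith

theorem exists_signed_permutation (hU : ∀ x, ‖U x‖ = ‖x‖) :
    ∃ (ε : ℕ+ → ℝ) (π : ℕ+ → ℕ+), Function.Injective π ∧ (∀ i, ε i = 1 ∨ ε i = -1) ∧
      (∀ i, (π i : ℕ) ≤ max (i : ℕ) ⌊(θ : ℝ)⁻¹⌋₊) ∧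
      ∀ i, U (e θ schreierOne i) = ε i • e θ schreierOne (π i) := by
  have hex : ∀ i, ∃ k, |coord θ schreierOne k (U (e θ schreierOne i))| = 1 := fun i =>
    exists_abs_coord_eq_one (by rw [hU, norm_e]) (exists_far_image hU i)
  choose π hπ using hex
  have hπ0 : ∀ i j, i ≠ j → coord θ schreierOne (π i) (U (e θ schreierOne j)) = 0 :=
    fun i j hij => coord_eq_zero_of_abs_coord_eq_one hU hij (hπ i)
  have hinj : Function.Injective π := fun i j hij => by
    by_contra hne
    have h1 := hπ0 i j hne
    have h2 := hπ j
    rw [← hij, h1, abs_zero] at h2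
    exact zero_ne_one h2
  have hle := index_le_max hU hinj hπ hπ0
  refine ⟨fun i => coord θ schreierOne (π i) (U (e θ schreierOne i)), π, hinj,
    fun i => eq_or_eq_neg_of_abs_eq (hπ i), hle, fun i => ext_coord fun k => ?_⟩
  -- By surjectivity every coordinate is some `π j`, where `U e_i` is known to vanish unless `j =
  -- i`.
  obtain ⟨j, rfl⟩ := surjective_of_le_max hinj hle k
  rw [map_smul, coord_e, smul_eq_mul]
  by_cases hij : i = j
  · subst hij
    simp
  · rw [hπ0 j i (Ne.symm hij), if_neg (fun h => hij (hinj h)), mul_zero]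

theorem norm_map_of_signed_permutation (N : ℕ) (hθN : (θ : ℝ) * N ≤ 1) {ε : ℕ+ → ℝ}
    (hε : ∀ i, |ε i| = 1) {σ : Equiv.Perm ℕ+} (hσ : ∀ i : ℕ+, N < (i : ℕ) → σ i = i)
    (hUe : ∀ i, U (e θ schreierOne i) = ε i • e θ schreierOne (σ i)) (x : T θ schreierOne) :
    ‖U x‖ = ‖x‖ := by
  have h0 : (0 : ℝ) ≤ θ := θ.2.1.le
  refine denseRange_emb.induction_on x (isClosed_eq (by fun_prop) (by fun_prop)) fun y => ?_
  set V : (ℕ+ →₀ ℝ) →ₗ[ℝ] (ℕ+ →₀ ℝ) :=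
    Finsupp.lsum ℝ fun j => ε j • Finsupp.lsingle (σ j) with hV
  have hUV : U.toLinearMap ∘ₗ emb θ schreierOne = emb θ schreierOne ∘ₗ V := by
    refine Finsupp.lhom_ext' fun j => LinearMap.ext_ring ?_
    simp only [hV, LinearMap.comp_apply, Finsupp.lsum_single, LinearMap.smul_apply,
      Finsupp.lsingle_apply, map_smul, emb_single, ContinuousLinearMap.coe_coe, hUe]
  have hVy : ∀ k, |V y (σ k)| = |y k| := fun k => by
    have : Finsupp.lapply (σ k) ∘ₗ V = ε k • Finsupp.lapply k := by
      refine Finsupp.lhom_ext fun j a => ?_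
      by_cases hjk : j = k
      · subst hjk
        simp [hV]
      · simp [hV, Finsupp.single_eq_of_ne' hjk, Finsupp.single_eq_of_ne' (σ.injective.ne hjk)]
    have hk : V y (σ k) = ε k * y k := by simpa using LinearMap.congr_fun this y
    rw [hk, abs_mul, hε, one_mul]
  have hVy' : ∀ k, |V y k| = |y (σ.symm k)| := fun k => by
    rw [← hVy, Equiv.apply_symm_apply]
  have hUy : U (emb θ schreierOne y) = emb θ schreierOne (V y) := LinearMap.congr_fun hUV y
  rw [hUy, norm_emb, norm_emb]
  -- `y` and `V y` have the same moduli beyond `N` and rearranged moduli overall, so domination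
  -- holds both ways.
  refine le_antisymm (tsNorm_le_of_tail h0 (coe_le_one θ) hθN (fun i _ => ⟨_, (hVy' i).le⟩)
    fun i hi => ?_) (tsNorm_le_of_tail h0 (coe_le_one θ) hθN (fun i _ => ⟨_, (hVy i).ge⟩)
    fun i hi => ?_)
  · have := hVy i
    rw [hσ i hi] at this
    exact this.le
  · have := hVy i
    rw [hσ i hi] at this
    exact this.ge

end Isometry

end Tsirelson

end

theorem theoremA (θ : Set.Ioc (0 : ℝ) (1 / 2))
    (U : Tsirelson.T θ Tsirelson.schreierOne →ₗ[ℝ] Tsirelson.T θ Tsirelson.schreierOne) :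
    Isometry U ↔
      Continuous U ∧
      ∃ (ε : ℕ+ → ℝ) (π : Equiv.Perm {i : ℕ+ // (i : ℕ) ≤ ⌊(θ : ℝ)⁻¹⌋₊}),
        (∀ i, ε i = 1 ∨ ε i = -1) ∧
        (∀ i : {i : ℕ+ // (i : ℕ) ≤ ⌊(θ : ℝ)⁻¹⌋₊},
          U (Tsirelson.e θ Tsirelson.schreierOne i) =
            ε i • Tsirelson.e θ Tsirelson.schreierOne (π i)) ∧
        (∀ i : ℕ+, ⌊(θ : ℝ)⁻¹⌋₊ < (i : ℕ) →
          U (Tsirelson.e θ Tsirelson.schreierOne i) =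
            ε i • Tsirelson.e θ Tsirelson.schreierOne i) := by
  constructor
  · intro hU
    refine ⟨hU.continuous, ?_⟩
    obtain ⟨ε, π, hinj, hε, hle, hπ⟩ := Tsirelson.exists_signed_permutation
      (U := ⟨U, hU.continuous⟩) fun x => hU.norm_map_of_map_zero (map_zero U) x
    have hmaps : ∀ i : ℕ+, (i : ℕ) ≤ ⌊(θ : ℝ)⁻¹⌋₊ → (π i : ℕ) ≤ ⌊(θ : ℝ)⁻¹⌋₊ := fun i hi =>
      (hle i).trans_eq (max_eq_right hi)
    let τ : {i : ℕ+ // (i : ℕ) ≤ ⌊(θ : ℝ)⁻¹⌋₊} → {i : ℕ+ // (i : ℕ) ≤ ⌊(θ : ℝ)⁻¹⌋₊} :=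
      fun i => ⟨π i, hmaps i i.2⟩
    have hτ : Function.Bijective τ := by
      refine ⟨fun i j hij => Subtype.ext (hinj (congrArg Subtype.val hij)), fun k => ?_⟩
      obtain ⟨i, hi, hik⟩ := Tsirelson.surjOn_of_le_max hinj hle le_rfl k.2
      exact ⟨⟨i, hi⟩, Subtype.ext hik⟩
    refine ⟨ε, Equiv.ofBijective τ hτ, hε, fun i => hπ i, fun i hi => ?_⟩
    have := hπ i
    rwa [Tsirelson.eq_self_of_le_max hinj hle hi] at this
  · rintro ⟨hcont, ε, π, hε, hsmall, hlarge⟩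
    have h0 : (0 : ℝ) < θ := θ.2.1
    have hθN : (θ : ℝ) * (⌊(θ : ℝ)⁻¹⌋₊ : ℕ) ≤ 1 := by
      have := mul_le_mul_of_nonneg_left (Nat.floor_le (inv_nonneg.2 h0.le)) h0.le
      rwa [mul_inv_cancel₀ h0.ne'] at this
    refine AddMonoidHomClass.isometry_of_norm U
      (Tsirelson.norm_map_of_signed_permutation (U := ⟨U, hcont⟩) ⌊(θ : ℝ)⁻¹⌋₊ hθN
        (ε := ε) (σ := Equiv.Perm.ofSubtype π) (fun i => ?_) (fun i hi => ?_) fun i => ?_)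
    · rcases hε i with h | h <;> simp [h]
    · exact Equiv.Perm.ofSubtype_apply_of_not_mem π (not_le.2 hi)
    · rcases le_or_gt (i : ℕ) ⌊(θ : ℝ)⁻¹⌋₊ with hi | hi
      · rw [Equiv.Perm.ofSubtype_apply_of_mem π hi]
        exact hsmall ⟨i, hi⟩
      · rw [Equiv.Perm.ofSubtype_apply_of_not_mem π (not_le.2 hi)]
        exact hlarge i hi
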